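/- **Setting.** Let $n\ge 1$. Write $B_\rho(x_0)\subset\mathbb R^n$ for the open ball, $(f)_B=\frac1{|B|}\int_B f\,dx$ for the Lebesgue mean, and $u^+=\max\{u,0\}$. A function $\omega:\mathbb R^n\to[0,\infty)$, locally integrable and not a.e. zero, belongs to $A_{1+\frac1n}$ if $$[\omega]_{A_{1+\frac1n}}=\sup_{x_0\in\mathbb R^n,\ \rho>0}(\omega)_{B_\rho(x_0)}\big[(\omega^{-n})_{B_\rho(x_0)}\big]^{1/n}<\infty ,$$ and then $\omega>0$ a.e. Put $\mu=\omega^{-n}$, and for an open set $\Omega\subset\mathbb R^n$ let $$[[\omega]]_{\mathrm{BMO}(\Omega,\omega)}=\sup_{B_\rho(z)\subset\Omega}\Big(\frac{1}{\omega(B_\rho(z))}\int_{B_\rho(z)}\big|\omega-(\omega)_{B_\rho(z)}\big|^{n+1}\omega^{-n}\,dx\Big)^{\frac1{n+1}},\qquad \omega(B)=\int_B\omega\,dx .$$ For $Y=(y,s)\in\mathbb R^n\times\mathbb R$ and $r>0$ let $$C_{r,\mu}(Y)=B_r(y)\times\big(s-r^2(\mu)_{B_r(y)}^{1/n},\,s\big),\qquad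 \mu(C_{r,\mu}(Y))=\int_{C_{r,\mu}(Y)}\mu(x)\,dx\,dt .$$ Let $\mathcal L u=u_t-\omega(x)\sum_{i,j=1}^n a_{ij}(x,t)D_{ij}u$. **Statement.** For every $n\ge1$, $K_0\in[1,\infty)$ and $\nu\in(0,1)$ there is $\overline\epsilon_0=\overline\epsilon_0(n,\nu,K_0)\in(0,1)$ such that, for every $q\in(0,\infty)$, there is $N=N(n,\nu,K_0,q)>0$ with the following property. Let $r>0$, $Y=(y,s)\in\mathbb R^{n+1}$, and let $\omega\in A_{1+\frac1n}$ satisfy $$[\omega]_{A_{1+\frac1n}}\le K_0\qquad\text{and}\qquad [[\omega]]_{\mathrm{BMO}(B_r(y),\omega)}\le\overline\epsilon_0 .$$ Let $(a_{ij})$ be measurable and symmetric in $C_{r,\mu}(Y)$, with $$\nu|\xi|^2\le \sum_{i,j}a_{ij}(x,t)\xi_i\xi_j\ \text{ for all }\xi\in\mathbb R^n,\qquad |a_{ij}(x,t)|\le\nu^{-1}\ \text{ for all } i,j,\qquad (x,t)\in C_{r,\mu}(Y).$$ Let $u\in C(\overline{C_{r,\mu}(Y)})$ be such that $u$, $u_t$,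 $D_iu$, $D_{ij}u$ exist and are continuous in $C_{r,\mu}(Y)$ (that is, $u\in C^{2,1}(C_{r,\mu}(Y))$), and suppose that $\mathcal Lu\le0$ almost everywhere in $C_{r,\mu}(Y)$. Then $$u^+(Y)\le N\Big(\frac1{\mu(C_{r,\mu}(Y))}\int_{C_{r,\mu}(Y)}u^+(x,t)^q\,\mu(x)\,dx\,dt\Big)^{1/q}.$$ -/

import Mathlib

open MeasureTheory Metric Set
open scoped ENNReal

noncomputable section

namespace WeightedParabolic

/-- Points `X = (x, t)` of `ℝⁿ × ℝ`. Its Lebesgue measure is `volume = dx dt`. -/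
abbrev SpaceTime (n : ℕ) : Type := EuclideanSpace ℝ (Fin n) × ℝ

/-! ### Muckenhoupt weights and weighted mean oscillation -/

/-- The characteristic `[σ]_{A_p}`, for `1 < p < ∞`: the supremum over all balls `B` of
`(σ)_B * ((σ^(-1/(p-1)))_B)^(p-1)`, computed in `[0, ∞]`, where `0` to a negative power is `∞`. -/
def muckenhouptChar {n : ℕ} (p : ℝ) (σ : EuclideanSpace ℝ (Fin n) → ℝ) : ℝ≥0∞ :=
  ⨆ (x₀ : EuclideanSpace ℝ (Fin n)) (ρ : ℝ) (_ : 0 < ρ),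
    (⨍⁻ x in ball x₀ ρ, ENNReal.ofReal (σ x) ∂volume) *
      (⨍⁻ x in ball x₀ ρ, ENNReal.ofReal (σ x) ^ (-1 / (p - 1)) ∂volume) ^ (p - 1)

/-- `σ ∈ A_p`, for `1 < p < ∞`. The field `ae_pos` only excludes the degenerate weight that
vanishes almost everywhere, for which the characteristic is an undetermined product `0 * ∞`: for
every other `σ` it follows from `char_lt_top`. Lebesgue measurability of `σ` is part of local
integrability. -/
structure IsMuckenhoupt {n : ℕ} (p : ℝ) (σ : EuclideanSpace ℝ (Fin n) → ℝ) : Prop where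
  nonneg : ∀ x, 0 ≤ σ x
  locallyIntegrable : LocallyIntegrable σ volume
  ae_pos : ∀ᵐ x, 0 < σ x
  char_lt_top : muckenhouptChar p σ < ∞

/-- The mean oscillation of `f` on the ball `B_r(y)` with respect to `ω`, with values in `[0, ∞]`:
`((1 / ω(B)) ∫_B |f - (f)_B|^(n+1) ω^(-n) dx)^(1/(n+1))`. -/
def weightedOsc {n : ℕ} (ω f : EuclideanSpace ℝ (Fin n) → ℝ)
    (y : EuclideanSpace ℝ (Fin n)) (r : ℝ) : ℝ≥0∞ :=
  ((∫⁻ x in ball y r,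
      ENNReal.ofReal |f x - ⨍ z in ball y r, f z| ^ (n + 1) * (ENNReal.ofReal (ω x) ^ n)⁻¹) /
    ∫⁻ x in ball y r, ENNReal.ofReal (ω x)) ^ (1 / ((n : ℝ) + 1))

/-- `[[f]]_{BMO(Ω, ω)}`: the supremum of the weighted mean oscillations over all balls in `Ω`. -/
def weightedBMO {n : ℕ} (ω f : EuclideanSpace ℝ (Fin n) → ℝ)
    (Ω : Set (EuclideanSpace ℝ (Fin n))) : ℝ≥0∞ :=
  ⨆ (y : EuclideanSpace ℝ (Fin n)) (r : ℝ) (_ : 0 < r) (_ : ball y r ⊆ Ω), weightedOsc ω f y r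

/-- The weight `μ = ω^(-n)`. (If `ω` is a Muckenhoupt weight, then `ω > 0` almost everywhere, so
the value `0` that is given to `μ` where `ω = 0` plays no role: `μ` is used under integrals
only.) -/
def mu {n : ℕ} (ω : EuclideanSpace ℝ (Fin n) → ℝ) (x : EuclideanSpace ℝ (Fin n)) : ℝ :=
  (ω x ^ n)⁻¹

/-- The weighted parabolic cylinder
`C_{r,μ}(Y) = B_r(y) × (s - r² ((μ)_{B_r(y)})^(1/n), s)`, where `Y = (y, s)`. -/
def parabolicCylinder {n : ℕ} (μ : EuclideanSpace ℝ (Fin n) → ℝ) (r : ℝ) (Y : SpaceTime n) :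
    Set (SpaceTime n) :=
  ball Y.1 r ×ˢ Ioo (Y.2 - r ^ 2 * (⨍ x in ball Y.1 r, μ x) ^ (1 / (n : ℝ))) Y.2

/-! ### Classical derivatives and the operator -/

/-- The partial derivative `u_t`. -/
def timeDeriv {n : ℕ} (u : SpaceTime n → ℝ) (X : SpaceTime n) : ℝ :=
  deriv (fun t => u (X.1, t)) X.2

/-- The partial derivative `D_i u` in the space variable `x_i`. -/
def spaceDeriv {n : ℕ} (i : Fin n) (u : SpaceTime n → ℝ) (X : SpaceTime n) : ℝ :=
  lineDeriv ℝ (fun x => u (x, X.2)) X.1 (EuclideanSpace.single i (1 : ℝ))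

/-- The partial derivative `D_i u` exists at `X`. -/
def HasSpaceDeriv {n : ℕ} (i : Fin n) (u : SpaceTime n → ℝ) (X : SpaceTime n) : Prop :=
  LineDifferentiableAt ℝ (fun x => u (x, X.2)) X.1 (EuclideanSpace.single i (1 : ℝ))

/-- `u ∈ C^{2,1}(Ω)`, for open `Ω`: the function `u` is continuous in `Ω`, and `u_t`, `D_i u`,
`D_{ij} u` exist and are continuous in `Ω`. -/
structure IsC21On {n : ℕ} (u : SpaceTime n → ℝ) (Ω : Set (SpaceTime n)) : Prop where
  continuousOn : ContinuousOn u Ω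
  time_exists : ∀ X ∈ Ω, DifferentiableAt ℝ (fun t => u (X.1, t)) X.2
  time_continuousOn : ContinuousOn (timeDeriv u) Ω
  space_exists : ∀ i, ∀ X ∈ Ω, HasSpaceDeriv i u X
  space_continuousOn : ∀ i, ContinuousOn (spaceDeriv i u) Ω
  space₂_exists : ∀ i j, ∀ X ∈ Ω, HasSpaceDeriv i (spaceDeriv j u) X
  space₂_continuousOn : ∀ i j, ContinuousOn (spaceDeriv i (spaceDeriv j u)) Ω

/-- The operator `𝓛 u = u_t - ω(x) ∑_{i,j} a_{ij}(x,t) D_{ij} u`. -/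
def parabolicOp {n : ℕ} (ω : EuclideanSpace ℝ (Fin n) → ℝ)
    (a : SpaceTime n → Matrix (Fin n) (Fin n) ℝ) (u : SpaceTime n → ℝ) (X : SpaceTime n) : ℝ :=
  timeDeriv u X - ω X.1 * ∑ i, ∑ j, a X i j * spaceDeriv i (spaceDeriv j u) X

/-- The conditions on the coefficients in `Ω`: `(a_{ij})` is (Lebesgue) measurable, symmetric,
uniformly elliptic and bounded, with constant `ν`. -/
structure IsElliptic {n : ℕ} (ν : ℝ) (a : SpaceTime n → Matrix (Fin n) (Fin n) ℝ)
    (Ω : Set (SpaceTime n)) : Prop where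
  aemeasurable : ∀ i j, AEMeasurable (fun X => a X i j) (volume.restrict Ω)
  symm : ∀ X ∈ Ω, (a X).IsSymm
  elliptic : ∀ X ∈ Ω, ∀ ξ : EuclideanSpace ℝ (Fin n),
    ν * ‖ξ‖ ^ 2 ≤ ∑ i, ∑ j, a X i j * ξ i * ξ j
  bounded : ∀ X ∈ Ω, ∀ i j, |a X i j| ≤ ν⁻¹

end WeightedParabolic

end

namespace WeightedParabolic

/-! ### Linear algebra -/

/-! The proof combines a density estimate at points where `u` nearly dominates its surroundings with
a weighted choice of such a point.

Choice of the point. Let `d` be the normalized distance to the parabolic boundary and `D =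
n(n+1)+n+2`. Take `X₀` where `d^(D/q) u` exceeds half of its supremum. On a cylinder `Q` below `X₀`
over a ball of radius `ρ = θ d(X₀) r`, the distance drops at most by the factor `1-θ`, so `u ≤ 4m`
there, with `m = u(X₀)`. If `u ≥ m/2` on a fixed fraction of the `μ`-measure of `Q`, Chebyshev
bounds `m^q` by a multiple of `μ(Q)⁻¹ ∫ (u⁺)^q μ`. Replacing `μ(Q)` by the measure of the whole
cylinder costs `(θ d)^(-D)` by doubling (`height_mul_le`), and the weight `d^(D/q)`, raised to the
power `q`, pays exactly for this.

Density (`krylovTso_subsolution`, `le_lintegral_superlevel`). Subtract from `u` a constant and a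
paraboloid. The map `X ↦ (Dv, v - Dv·(x-x₀))` has Jacobian `det D²v · v_t` and sends the contact set
(`v ≥ 0`, `v_t ≥ 0`, `D²v ≤ 0`) onto a set of measure at least a multiple of `m^(n+1) ρ^(-n)`. On
the contact set the two parts of the operator are both nonnegative, so the Jacobian is at most a
multiple of `F^(n+1) ω^(-n)`, where `F` is comparable to `m ρ⁻² (τ⁻¹ + ω)` and `τ = (μ)_B^(1/n)`.
The `A_{1+1/n}` condition bounds the mean `W` of `ω` by `K₀/τ`, so writing `ω ≤ W + |ω-W|` leaves
`τ^(-(n+1)) μ`, whose integral is controlled by the measure of `{u ≥ m/2}`, and `|ω-W|^(n+1) μ`,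
whose integral is small by the oscillation hypothesis and is absorbed. Only this absorption fixes
`ε`, hence `ε` does not depend on `q`.

Regularity. The area formula needs `Dv` differentiable in time as well, which `C^{2,1}` does not
give. Steklov averages in time supply it, with `v`, `v_t` and `D²v` uniformly close to those of `u`
(`exists_approx_of_isC21On`). The equation itself is never averaged; the error is absorbed into `F`.
-/

theorem det_le_trace_pow {n : ℕ} {H : Matrix (Fin n) (Fin n) ℝ} (hH : H.PosSemidef) :
    H.det ≤ H.trace ^ n := by
  rw [hH.1.det_eq_prod_eigenvalues, hH.1.trace_eq_sum_eigenvalues]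
  calc _ ≤ ∏ _i : Fin n, ∑ j, hH.1.eigenvalues j :=
        Finset.prod_le_prod (fun i _ => hH.eigenvalues_nonneg i)
          (fun i _ => Finset.single_le_sum (f := hH.1.eigenvalues)
            (fun j _ => hH.eigenvalues_nonneg j) (Finset.mem_univ i))
    _ = _ := by simp

/-- Factor `H = BᵀB`: the double sum becomes the sum of the quadratic form of `A` over the rows of
`B`, and the trace is the sum of the squared lengths of these rows. -/
theorem mul_trace_le_sum_mul {n : ℕ} {ν : ℝ} {A H : Matrix (Fin n) (Fin n) ℝ}
    (hA : ∀ ξ : Fin n → ℝ, ν * ∑ i, ξ i ^ 2 ≤ ∑ i, ∑ j, A i j * ξ i * ξ j)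
    (hH : H.PosSemidef) : ν * H.trace ≤ ∑ i, ∑ j, A i j * H i j := by
  obtain ⟨B, rfl⟩ : ∃ B : Matrix (Fin n) (Fin n) ℝ, H = B.conjTranspose * B := by
    open scoped MatrixOrder in
    exact CStarAlgebra.nonneg_iff_eq_star_mul_self.1 hH.nonneg
  have h1 : (B.conjTranspose * B).trace = ∑ k, ∑ i, B k i ^ 2 := by
    rw [Finset.sum_comm]
    simp [Matrix.trace, Matrix.mul_apply, sq]
  have h2 : ∑ i, ∑ j, A i j * (B.conjTranspose * B) i j
      = ∑ k, ∑ i, ∑ j, A i j * B k i * B k j := by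
    rw [Finset.sum_comm]
    simp only [Matrix.mul_apply, Matrix.conjTranspose_apply, star_trivial, Finset.mul_sum]
    rw [Finset.sum_comm]
    conv_rhs => rw [Finset.sum_comm]
    refine Finset.sum_congr rfl fun i _ => ?_
    rw [Finset.sum_comm]
    simp [mul_assoc]
  rw [h1, h2, Finset.mul_sum]
  exact Finset.sum_le_sum fun k _ => hA (B k)

/-- The determinant of a block upper triangular endomorphism of `E × ℝ`. -/
theorem det_block_upper {n : ℕ} (L : SpaceTime n →ₗ[ℝ] SpaceTime n)
    (H : Matrix (Fin n) (Fin n) ℝ) (k : Fin n → ℝ) (b : ℝ)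
    (h1 : ∀ X i, (L X).1 i = ∑ j, H i j * X.1 j + k i * X.2)
    (h2 : ∀ X, (L X).2 = b * X.2) : LinearMap.det L = H.det * b := by
  let B := (EuclideanSpace.basisFun (Fin n) ℝ).toBasis.prod (Module.Basis.singleton Unit ℝ)
  rw [← LinearMap.det_toMatrix B L]
  have : LinearMap.toMatrix B B L
      = Matrix.fromBlocks H (Matrix.of fun i _ => k i) 0 (Matrix.of fun _ _ => b) := by
    ext (i | i) (j | j)
    · simp [B, LinearMap.toMatrix_apply, h1]
    · simp [B, LinearMap.toMatrix_apply, h1]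
    · simp [B, LinearMap.toMatrix_apply, h2]
    · simp [B, LinearMap.toMatrix_apply, h2]
  rw [this, Matrix.det_fromBlocks_zero₂₁]
  simp

/-- The determinant of a shear of `E × ℝ`. -/
theorem det_shear {n : ℕ} (L : SpaceTime n →ₗ[ℝ] SpaceTime n) (l : Fin n → ℝ)
    (h1 : ∀ X, (L X).1 = X.1)
    (h2 : ∀ X, (L X).2 = X.2 + ∑ j, l j * X.1 j) : LinearMap.det L = 1 := by
  let B := (EuclideanSpace.basisFun (Fin n) ℝ).toBasis.prod (Module.Basis.singleton Unit ℝ)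
  rw [← LinearMap.det_toMatrix B L]
  have : LinearMap.toMatrix B B L
      = Matrix.fromBlocks 1 0 (Matrix.of fun _ j => l j) 1 := by
    ext (i | i) (j | j)
    · simp [B, LinearMap.toMatrix_apply, h1, Matrix.one_apply]
    · simp [B, LinearMap.toMatrix_apply, h1]
    · simp [B, LinearMap.toMatrix_apply, h2]
    · simp [B, LinearMap.toMatrix_apply, h2]
  rw [this, Matrix.det_fromBlocks_zero₁₂]
  simp

/-! ### Functions with continuous partial derivatives -/

/-- A function with partial derivatives near `x₀` that are continuous at `x₀` is differentiable
at `x₀`. -/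
theorem hasFDerivAt_of_partial {G ι : Type*} [NormedAddCommGroup G] [NormedSpace ℝ G]
    [Fintype ι] (e : ι → G) (c : ι → G →L[ℝ] ℝ) (hec : ∀ h, ∑ i, c i h • e i = h)
    {f : G → ℝ} {df : ι → G → ℝ} {x₀ : G}
    (hd : ∀ᶠ x in nhds x₀, ∀ i, HasDerivAt (fun s : ℝ => f (x + s • e i)) (df i x) 0)
    (hc : ∀ i, ContinuousAt (df i) x₀) :
    HasFDerivAt f (∑ i, df i x₀ • c i) x₀ := by
  classical
  -- The coordinates are moved one at a time. Each new increment is compared with its linearization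
  -- by the mean value inequality along a segment in direction `e j`, on which `df j` stays close to
  -- `df j x₀`.
  have key : ∀ S : Finset ι, (fun h : G => f (x₀ + ∑ i ∈ S, c i h • e i) - f x₀
      - ∑ i ∈ S, df i x₀ * c i h) =o[nhds 0] fun h : G => h := by
    intro S
    induction S using Finset.induction_on with
    | empty => simp
    | insert j S hj ih =>
      have step : (fun h : G => f (x₀ + ∑ i ∈ S, c i h • e i + c j h • e j)
          - f (x₀ + ∑ i ∈ S, c i h • e i) - df j x₀ * c j h) =o[nhds 0] fun h : G => h := by
        rw [Asymptotics.isLittleO_iff]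
        intro ε hε
        -- The `+ 1` guards against `c j = 0`.
        have hε' : 0 < ε / (‖c j‖ + 1) := by positivity
        have hnear : ∀ᶠ x in nhds x₀, HasDerivAt (fun s : ℝ => f (x + s • e j)) (df j x) 0 ∧
            |df j x - df j x₀| ≤ ε / (‖c j‖ + 1) := by
          filter_upwards [hd, (hc j).eventually (Metric.closedBall_mem_nhds _ hε')] with x h1 h2
          exact ⟨h1 j, by simpa [Real.dist_eq] using h2⟩
        obtain ⟨δ, hδ, hball⟩ := Metric.eventually_nhds_iff_ball.1 hnear
        let T : G → ℝ := fun h => ∑ i ∈ S, ‖c i h‖ * ‖e i‖ + ‖c j h‖ * ‖e j‖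
        have hT : ∀ᶠ h in nhds (0 : G), T h < δ := by
          have : Continuous T := by fun_prop
          have := this.tendsto 0
          simp only [T, map_zero, norm_zero, zero_mul, Finset.sum_const_zero, add_zero] at this
          exact this.eventually (gt_mem_nhds hδ)
        filter_upwards [hT] with h hh
        set z := x₀ + ∑ i ∈ S, c i h • e i with hz
        have hmem : ∀ s ∈ segment ℝ 0 (c j h), z + s • e j ∈ ball x₀ δ := by
          intro s hs
          rw [mem_ball, dist_eq_norm]
          have hs' : ‖s‖ ≤ ‖c j h‖ := by
            obtain ⟨θ, hθ, rfl⟩ := (segment_eq_image ℝ 0 (c j h) ▸ hs)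
            have e1 : (1 - θ) • (0 : ℝ) + θ • (c j h) = θ * c j h := by simp
            beta_reduce
            rw [e1, norm_mul]
            have : ‖θ‖ ≤ 1 := by rw [Real.norm_eq_abs, abs_of_nonneg hθ.1]; exact hθ.2
            nlinarith [norm_nonneg (c j h)]
          calc ‖z + s • e j - x₀‖ = ‖∑ i ∈ S, c i h • e i + s • e j‖ := by
                rw [hz]; congr 1; abel
            _ ≤ ∑ i ∈ S, ‖c i h‖ * ‖e i‖ + ‖s‖ * ‖e j‖ := by
                refine (norm_add_le _ _).trans (add_le_add ((norm_sum_le _ _).trans ?_) ?_)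
                · exact le_of_eq (Finset.sum_congr rfl fun i _ => norm_smul _ _)
                · exact (norm_smul _ _).le
            _ ≤ T h := by
                have := mul_le_mul_of_nonneg_right hs' (norm_nonneg (e j))
                simp only [T]; linarith
            _ < δ := hh
        have hder : ∀ s ∈ segment ℝ 0 (c j h),
            HasDerivWithinAt (fun s : ℝ => f (z + s • e j) - df j x₀ * s)
              (df j (z + s • e j) - df j x₀) (segment ℝ 0 (c j h)) s := by
          intro s hs
          have h1 := (hball _ (hmem s hs)).1
          have h2 : HasDerivAt (fun s' : ℝ => f (z + s' • e j)) (df j (z + s • e j)) s := by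
            have h3 : HasDerivAt (fun s' : ℝ => s' - s) 1 s := (hasDerivAt_id s).sub_const s
            have h4 := HasDerivAt.comp s (by simpa using h1) h3
            simp only [mul_one] at h4
            refine h4.congr_of_eventuallyEq (Filter.Eventually.of_forall fun s' => ?_)
            simp only [Function.comp]
            congr 1
            rw [sub_smul]
            abel
          have h3 := h2.sub ((hasDerivAt_id s).const_mul (df j x₀))
          simp only [mul_one] at h3
          exact h3.hasDerivWithinAt
        have hbd := (convex_segment (0 : ℝ) (c j h)).norm_image_sub_le_of_norm_hasDerivWithin_le
          hder (fun s hs => (hball _ (hmem s hs)).2) (left_mem_segment ℝ _ _)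
          (right_mem_segment ℝ _ _)
        simp only [zero_smul, add_zero, mul_zero, sub_zero] at hbd
        calc ‖f (z + c j h • e j) - f z - df j x₀ * c j h‖
            = ‖f (z + c j h • e j) - df j x₀ * c j h - f z‖ := by congr 1; ring
          _ ≤ ε / (‖c j‖ + 1) * ‖c j h‖ := hbd
          _ ≤ ε / (‖c j‖ + 1) * (‖c j‖ * ‖h‖) := by gcongr; exact (c j).le_opNorm h
          _ ≤ ε / (‖c j‖ + 1) * ((‖c j‖ + 1) * ‖h‖) := by gcongr; linarith
          _ = ε * ‖h‖ := by field_simp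
      refine (ih.add step).congr_left fun h => ?_
      rw [Finset.sum_insert hj, Finset.sum_insert hj, add_comm (c j h • e j), ← add_assoc]
      ring
  rw [hasFDerivAt_iff_isLittleO_nhds_zero]
  refine (key Finset.univ).congr_left fun h => ?_
  rw [hec h]
  simp

/-- The coordinate functional `x ↦ x_i` on `ℝⁿ`. -/
noncomputable def coord {n : ℕ} (i : Fin n) : EuclideanSpace ℝ (Fin n) →L[ℝ] ℝ :=
  EuclideanSpace.proj i

@[simp] theorem coord_apply {n : ℕ} (i : Fin n) (x : EuclideanSpace ℝ (Fin n)) :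
    coord i x = x i := rfl

/-- The linear functional `dx_i` on `ℝⁿ × ℝ`. -/
noncomputable def dx {n : ℕ} (i : Fin n) : SpaceTime n →L[ℝ] ℝ :=
  (EuclideanSpace.proj i).comp (ContinuousLinearMap.fst ℝ _ _)

/-- The linear functional `dt` on `ℝⁿ × ℝ`. -/
noncomputable def dt {n : ℕ} : SpaceTime n →L[ℝ] ℝ := ContinuousLinearMap.snd ℝ _ _

@[simp] theorem dx_apply {n : ℕ} (i : Fin n) (X : SpaceTime n) : dx i X = X.1 i := rfl

@[simp] theorem dt_apply {n : ℕ} (X : SpaceTime n) : dt X = X.2 := rfl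

theorem sum_smul_single {n : ℕ} (x : EuclideanSpace ℝ (Fin n)) :
    ∑ i, x i • EuclideanSpace.single i (1 : ℝ) = x := by
  ext j
  simp [Pi.single_apply]

theorem hasFDerivAt_spaceTime {n : ℕ} {f : SpaceTime n → ℝ} {df : Fin n → SpaceTime n → ℝ}
    {ft : SpaceTime n → ℝ} {Ω : Set (SpaceTime n)} (hΩ : IsOpen Ω)
    (hx : ∀ i, ∀ X ∈ Ω, HasLineDerivAt ℝ (fun x => f (x, X.2)) (df i X) X.1
      (EuclideanSpace.single i (1 : ℝ)))
    (ht : ∀ X ∈ Ω, HasDerivAt (fun t => f (X.1, t)) (ft X) X.2)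
    (hcx : ∀ i, ContinuousOn (df i) Ω) (hct : ContinuousOn ft Ω) {X : SpaceTime n} (hX : X ∈ Ω) :
    HasFDerivAt f (∑ i, df i X • dx i + ft X • dt) X := by
  let e : Option (Fin n) → SpaceTime n := fun o =>
    o.elim (0, 1) fun i => (EuclideanSpace.single i (1 : ℝ), 0)
  let c : Option (Fin n) → SpaceTime n →L[ℝ] ℝ := fun o => o.elim dt dx
  let d : Option (Fin n) → SpaceTime n → ℝ := fun o => o.elim ft df
  have h := hasFDerivAt_of_partial (f := f) (df := d) (x₀ := X) e c ?_ ?_ ?_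
  · simpa [d, c, Fintype.sum_option, add_comm] using h
  · intro Z
    rw [Fintype.sum_option]
    ext j
    · simp [c, e, Pi.single_apply, Prod.fst_sum]
    · simp [c, e, Prod.snd_sum]
  · filter_upwards [hΩ.mem_nhds hX] with Z hZ
    rintro (_ | i)
    · have h1 : HasDerivAt (fun s : ℝ => Z.2 + s) 1 0 := by
        simpa using (hasDerivAt_id (0 : ℝ)).const_add Z.2
      have h2 := HasDerivAt.comp (0 : ℝ) (by simpa using ht Z hZ) h1
      have e1 : (fun s : ℝ => f (Z + s • e none)) = fun s => f (Z.1, Z.2 + s) := by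
        funext s
        congr 1
        ext <;> simp [e]
      rw [e1]
      simpa [d, Function.comp_def] using! h2
    · have e1 : (fun s : ℝ => f (Z + s • e (some i)))
          = fun s => f (Z.1 + s • EuclideanSpace.single i (1 : ℝ), Z.2) := by
        funext s
        congr 1
        ext <;> simp [e]
      rw [e1]
      exact hx i Z hZ
  · rintro (_ | i)
    · exact hct.continuousAt (hΩ.mem_nhds hX)
    · exact (hcx i).continuousAt (hΩ.mem_nhds hX)

theorem hasFDerivAt_space {n : ℕ} {f : EuclideanSpace ℝ (Fin n) → ℝ}
    {df : Fin n → EuclideanSpace ℝ (Fin n) → ℝ}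
    {Ω : Set (EuclideanSpace ℝ (Fin n))} (hΩ : IsOpen Ω)
    (hx : ∀ i, ∀ x ∈ Ω, HasLineDerivAt ℝ f (df i x) x (EuclideanSpace.single i (1 : ℝ)))
    (hcx : ∀ i, ContinuousOn (df i) Ω) {x : EuclideanSpace ℝ (Fin n)} (hX : x ∈ Ω) :
    HasFDerivAt f (∑ i, df i x • coord i) x :=
  hasFDerivAt_of_partial (fun i => EuclideanSpace.single i (1 : ℝ))
    coord (fun h => by simpa using sum_smul_single h)
    (by filter_upwards [hΩ.mem_nhds hX] with z hz i using hx i z hz)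
    (fun i => (hcx i).continuousAt (hΩ.mem_nhds hX))

/-- Symmetry of the Hessian. -/
theorem hessian_symm {n : ℕ} {f : EuclideanSpace ℝ (Fin n) → ℝ}
    {g : Fin n → EuclideanSpace ℝ (Fin n) → ℝ} {H : Matrix (Fin n) (Fin n) ℝ}
    {x : EuclideanSpace ℝ (Fin n)}
    (hf : ∀ᶠ z in nhds x, HasFDerivAt f
      (∑ i, g i z • coord i) z)
    (hg : ∀ i, HasFDerivAt (g i)
      (∑ j, H i j • coord j) x) :
    H.IsSymm := by
  have h2 : HasFDerivAt
      (fun z => ∑ i, g i z • coord i)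
      (∑ i, (∑ j, H i j • coord j).smulRight (coord i)) x :=
    HasFDerivAt.fun_sum fun i _ =>
      (hg i).smul_const (F := EuclideanSpace ℝ (Fin n) →L[ℝ] ℝ) (coord i)
  ext i j
  have := second_derivative_symmetric_of_eventually hf h2
    (EuclideanSpace.single i (1 : ℝ)) (EuclideanSpace.single j (1 : ℝ))
  simpa [Pi.single_apply] using this

/-! ### The parabolic contact set -/

/-- If `c > 0`, the second derivative test makes `x` a local minimum too; then `φ` is constant near
`x` and `c = 0`. -/
theorem second_deriv_nonpos_of_isLocalMax {φ φ' : ℝ → ℝ} {c x : ℝ} (hmax : IsLocalMax φ x)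
    (h1 : ∀ᶠ s in nhds x, HasDerivAt φ (φ' s) s) (h2 : HasDerivAt φ' c x) : c ≤ 0 := by
  by_contra! hc
  have e1 : deriv φ =ᶠ[nhds x] φ' := h1.mono fun s hs => hs.deriv
  have e2 : deriv (deriv φ) x = c := (h2.congr_of_eventuallyEq e1).deriv
  have hmin : IsLocalMin φ x := isLocalMin_of_deriv_deriv_pos (by rw [e2]; exact hc)
    hmax.deriv_eq_zero h1.self_of_nhds.continuousAt
  have hconst : φ =ᶠ[nhds x] fun _ => φ x := by
    filter_upwards [hmax, hmin] with s h3 h4 using le_antisymm h3 h4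
  have e3 : deriv φ =ᶠ[nhds x] deriv fun _ => φ x := hconst.deriv
  have e4 : deriv (deriv φ) x = 0 := by
    rw [e3.deriv_eq]
    simp
  linarith

theorem deriv_nonneg_of_le_left {φ : ℝ → ℝ} {c a b : ℝ} (hab : a < b) (h : HasDerivAt φ c b)
    (hle : ∀ t ∈ Ico a b, φ t ≤ φ b) : 0 ≤ c := by
  have h1 : Filter.Tendsto (slope φ b) (nhdsWithin b (Iio b)) (nhds c) :=
    (hasDerivAt_iff_tendsto_slope_left_right.1 h).1
  refine ge_of_tendsto h1 ?_
  filter_upwards [Ico_mem_nhdsLT hab] with t ht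
  rw [slope_def_field]
  exact div_nonneg_of_nonpos (by linarith [hle t ht]) (by linarith [ht.2])

theorem abs_sum_mul_le {n : ℕ} (p z : EuclideanSpace ℝ (Fin n)) :
    |∑ i, p i * z i| ≤ ‖p‖ * ‖z‖ := by
  have h := abs_real_inner_le_norm p z
  rw [PiLp.inner_apply] at h
  simpa [mul_comm] using h

/-- The contact set, where `v ≥ 0`, `v_t ≥ 0` and `D²v ≤ 0`. -/
def contactSet {n : ℕ} (K : Set (SpaceTime n)) (v β : SpaceTime n → ℝ)
    (H : SpaceTime n → Matrix (Fin n) (Fin n) ℝ) : Set (SpaceTime n) :=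
  {X | X ∈ K ∧ 0 ≤ v X ∧ 0 ≤ β X ∧ ∀ ξ : Fin n → ℝ, ∑ i, ∑ j, H X i j * ξ i * ξ j ≤ 0}

theorem isClosed_contactSet {n : ℕ} {K : Set (SpaceTime n)} {v β : SpaceTime n → ℝ}
    {H : SpaceTime n → Matrix (Fin n) (Fin n) ℝ} (hK : IsClosed K) (hv : ContinuousOn v K)
    (hβ : ContinuousOn β K) (hH : ∀ i j, ContinuousOn (fun X => H X i j) K) :
    IsClosed (contactSet K v β H) := by
  have e : contactSet K v β H = (K ∩ v ⁻¹' Ici 0) ∩ (K ∩ β ⁻¹' Ici 0) ∩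
      ⋂ ξ : Fin n → ℝ, K ∩ (fun X => ∑ i, ∑ j, H X i j * ξ i * ξ j) ⁻¹' Iic 0 := by
    ext X
    simp only [contactSet, mem_ofPred_eq, mem_inter_iff, mem_preimage, mem_Ici, mem_iInter, mem_Iic]
    exact ⟨fun h => ⟨⟨⟨h.1, h.2.1⟩, h.1, h.2.2.1⟩, fun ξ => ⟨h.1, h.2.2.2 ξ⟩⟩,
      fun h => ⟨h.1.1.1, h.1.1.2, h.1.2.2, fun ξ => (h.2 ξ).2⟩⟩
  rw [e]
  refine ((hv.preimage_isClosed_of_isClosed hK isClosed_Ici).inter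
    (hβ.preimage_isClosed_of_isClosed hK isClosed_Ici)).inter
    (isClosed_iInter fun ξ => ContinuousOn.preimage_isClosed_of_isClosed ?_ hK isClosed_Iic)
  exact continuousOn_finsetSum _ fun i _ => continuousOn_finsetSum _ fun j _ =>
    ((hH i j).mul continuousOn_const).mul continuousOn_const

/-- The parabolic Legendre transform `X ↦ (Dv, v - Dv · (x - x₀))`. -/
noncomputable def legendreMap {n : ℕ} (x₀ : EuclideanSpace ℝ (Fin n)) (v : SpaceTime n → ℝ)
    (g : Fin n → SpaceTime n → ℝ) (X : SpaceTime n) : SpaceTime n :=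
  (∑ i, g i X • EuclideanSpace.single i (1 : ℝ), v X - ∑ i, g i X * (X.1 i - x₀ i))

/-- In the differential of `v - Dv·(x-x₀)` the terms `g i dx_i` cancel, leaving `β dt` minus a
combination of the differentials of the `g i`. The derivative is thus a shear composed with a block
triangular map with diagonal blocks `H` and `β`; the mixed derivatives `k` do not enter the
determinant. -/
theorem exists_hasFDerivAt_legendreMap {n : ℕ} {x₀ : EuclideanSpace ℝ (Fin n)}
    {v : SpaceTime n → ℝ} {g : Fin n → SpaceTime n → ℝ} {H : Matrix (Fin n) (Fin n) ℝ}
    {k : Fin n → ℝ} {β : ℝ} {X : SpaceTime n}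
    (hv : HasFDerivAt v (∑ i, g i X • dx i + β • dt) X)
    (hg : ∀ i, HasFDerivAt (g i) (∑ j, H i j • dx j + k i • dt) X) :
    ∃ L : SpaceTime n →L[ℝ] SpaceTime n, HasFDerivAt (legendreMap x₀ v g) L X ∧
      L.det = H.det * β := by
  have h1 : HasFDerivAt (fun X => ∑ i, g i X • EuclideanSpace.single i (1 : ℝ))
      (∑ i, (∑ j, H i j • dx j + k i • dt).smulRight
        (EuclideanSpace.single i (1 : ℝ))) X :=
    HasFDerivAt.fun_sum fun i _ => (hg i).smul_const _
  have hdx : ∀ i, HasFDerivAt (fun X : SpaceTime n => X.1 i - x₀ i) (dx i) X := fun i =>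
    (dx i).hasFDerivAt.sub_const (x₀ i)
  have h2 : HasFDerivAt (fun X => v X - ∑ i, g i X * (X.1 i - x₀ i))
      ((∑ i, g i X • dx i + β • dt) - ∑ i, (g i X • dx i
        + (X.1 i - x₀ i) • (∑ j, H i j • dx j + k i • dt))) X :=
    hv.sub (HasFDerivAt.fun_sum fun i _ => (hg i).mul (hdx i))
  refine ⟨_, h1.prodMk h2, ?_⟩
  set L := (∑ i, (∑ j, H i j • dx j + k i • dt).smulRight
        (EuclideanSpace.single i (1 : ℝ))).prod
      ((∑ i, g i X • dx i + β • dt) - ∑ i, (g i X • dx i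
        + (X.1 i - x₀ i) • (∑ j, H i j • dx j + k i • dt))) with hL
  let T : SpaceTime n →ₗ[ℝ] SpaceTime n := LinearMap.prod
    (∑ i, (∑ j, H i j • dx j + k i • dt : SpaceTime n →L[ℝ] ℝ).toLinearMap.smulRight
      (EuclideanSpace.single i (1 : ℝ))) (β • (dt : SpaceTime n →L[ℝ] ℝ).toLinearMap)
  let S : SpaceTime n →ₗ[ℝ] SpaceTime n := LinearMap.prod (LinearMap.fst ℝ _ _)
    ((dt - ∑ i, (X.1 i - x₀ i) • dx i : SpaceTime n →L[ℝ] ℝ).toLinearMap)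
  have hT1 : ∀ Z i, (T Z).1 i = ∑ j, H i j * Z.1 j + k i * Z.2 := by
    intro Z i
    simp [T, Pi.single_apply]
  have hT2 : ∀ Z, (T Z).2 = β * Z.2 := by
    intro Z
    simp [T]
  have hS2 : ∀ Z, (S Z).2 = Z.2 + ∑ j, -(X.1 j - x₀ j) * Z.1 j := by
    intro Z
    simp [S, sub_eq_add_neg]
    rw [← Finset.sum_neg_distrib]
    exact Finset.sum_congr rfl fun i _ => by ring
  have hLST : L.toLinearMap = S ∘ₗ T := by
    refine LinearMap.ext fun Z => Prod.ext ?_ ?_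
    · simp [L, S, T]
    · rw [LinearMap.comp_apply, hS2, hT2]
      simp only [hT1]
      simp [L, Finset.sum_add_distrib]
      rw [sub_eq_add_neg, ← Finset.sum_add_distrib, ← Finset.sum_neg_distrib]
      congr 1
      exact Finset.sum_congr rfl fun i _ => by ring
  rw [ContinuousLinearMap.det, hLST, LinearMap.det_comp, det_block_upper T H k β hT1 hT2,
    det_shear S (fun j => -(X.1 j - x₀ j)) (fun Z => rfl) hS2, one_mul]

/-- Every slope `p` and height `h` in a suitable cone is attained on the contact set. -/
theorem mem_legendreMap_image {n : ℕ} {x₀ : EuclideanSpace ℝ (Fin n)} {ρ a b M : ℝ} (hρ : 0 < ρ)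
    (hab : a ≤ b) {v : SpaceTime n → ℝ} {g : Fin n → SpaceTime n → ℝ}
    {H : SpaceTime n → Matrix (Fin n) (Fin n) ℝ} {k : Fin n → SpaceTime n → ℝ}
    {β : SpaceTime n → ℝ}
    (hv : ∀ X ∈ closedBall x₀ ρ ×ˢ Icc a b, HasFDerivAt v (∑ i, g i X • dx i + β X • dt) X)
    (hg : ∀ X ∈ closedBall x₀ ρ ×ˢ Icc a b, ∀ i,
      HasFDerivAt (g i) (∑ j, H X i j • dx j + k i X • dt) X)
    (hbot : ∀ x ∈ closedBall x₀ ρ, v (x, a) ≤ 0)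
    (hlat : ∀ x ∈ sphere x₀ ρ, ∀ t ∈ Icc a b, v (x, t) ≤ 0)
    (hM : M ≤ v (x₀, b)) {p : EuclideanSpace ℝ (Fin n)} {h : ℝ} (hph : ‖p‖ * ρ < h) (hh : h < M) :
    (p, h) ∈ legendreMap x₀ v g '' contactSet (closedBall x₀ ρ ×ˢ Icc a b) v β H := by
  set K := closedBall x₀ ρ ×ˢ Icc a b with hK
  have hKc : IsCompact K := (isCompact_closedBall _ _).prod isCompact_Icc
  let φ : SpaceTime n → ℝ := fun X => v X - ∑ i, p i * (X.1 i - x₀ i)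
  have hφd : ∀ X ∈ K, HasFDerivAt φ (∑ i, (g i X - p i) • dx i + β X • dt) X := by
    intro X hX
    have h1 : HasFDerivAt (fun X : SpaceTime n => ∑ i, p i * (X.1 i - x₀ i))
        (∑ i, p i • dx i) X :=
      HasFDerivAt.fun_sum fun i _ => ((dx i).hasFDerivAt.sub_const (x₀ i)).const_mul (p i)
    have h2 := (hv X hX).sub h1
    have e : ∑ i, (g i X - p i) • dx i + β X • dt
        = ∑ i, g i X • dx i + β X • dt - ∑ i, p i • dx i := by
      refine ContinuousLinearMap.ext fun Z => ?_
      simp [sub_mul, Finset.sum_sub_distrib]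
      ring
    rw [e]
    exact h2
  have hφc : ContinuousOn φ K := fun X hX => (hφd X hX).continuousAt.continuousWithinAt
  have hlin : ∀ x ∈ closedBall x₀ ρ, |∑ i, p i * (x i - x₀ i)| ≤ ‖p‖ * ρ := by
    intro x hx
    refine (abs_sum_mul_le p (x - x₀)).trans ?_
    gcongr
    rwa [← dist_eq_norm]
  have hx₀ : x₀ ∈ closedBall x₀ ρ := mem_closedBall_self hρ.le
  -- The contact point is a point of earliest time in the superlevel set `{φ ≥ h}` of `φ = v -
  -- p·(x-x₀)`. Before that time `φ < h`, and at that time `φ ≤ h` with equality at the point, so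
  -- `φ` has a spatial maximum there and a nonnegative time derivative.
  let T := K ∩ φ ⁻¹' Ici h
  have hTc : IsCompact T :=
    hKc.of_isClosed_subset (hφc.preimage_isClosed_of_isClosed hKc.isClosed isClosed_Ici)
      inter_subset_left
  have hTne : T.Nonempty := by
    refine ⟨(x₀, b), ⟨hx₀, right_mem_Icc.2 hab⟩, ?_⟩
    simp only [mem_preimage, mem_Ici, φ, sub_self, mul_zero, Finset.sum_const_zero, sub_zero]
    linarith
  obtain ⟨X₁, ⟨hX₁, hX₁h⟩, hmin⟩ := hTc.exists_isMinOn hTne continuous_snd.continuousOn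
  obtain ⟨x₁, t₁⟩ := X₁
  have hx₁ : x₁ ∈ closedBall x₀ ρ := hX₁.1
  have ht₁ : t₁ ∈ Icc a b := hX₁.2
  simp only [mem_preimage, mem_Ici] at hX₁h
  have hlt : ∀ x ∈ closedBall x₀ ρ, ∀ t ∈ Ico a t₁, φ (x, t) < h := by
    intro x hx t ht
    by_contra! hcon
    have : t₁ ≤ t := hmin (a := (x, t)) ⟨⟨hx, ht.1, ht.2.le.trans ht₁.2⟩, hcon⟩
    exact absurd ht.2 (not_lt.2 this)
  -- On the bottom, as on the lateral boundary below, `v ≤ 0` gives `φ ≤ ‖p‖ρ < h`.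
  have hat₁ : a < t₁ := by
    refine lt_of_le_of_ne ht₁.1 fun hat => ?_
    subst hat
    have := hbot x₁ hx₁
    have h3 := (abs_le.1 (hlin x₁ hx₁)).1
    simp only [φ] at hX₁h
    linarith
  have hle : ∀ x ∈ closedBall x₀ ρ, φ (x, t₁) ≤ h := by
    intro x hx
    have hc : ContinuousAt (fun t => φ (x, t)) t₁ :=
      (hφd (x, t₁) ⟨hx, ht₁⟩).continuousAt.comp (f := fun t : ℝ => (x, t))
        (Continuous.continuousAt (by fun_prop))
    refine le_of_tendsto (hc.continuousWithinAt (s := Iio t₁)) ?_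
    filter_upwards [Ico_mem_nhdsLT hat₁] with t ht using (hlt x hx t ht).le
  have heq : φ (x₁, t₁) = h := le_antisymm (hle x₁ hx₁) hX₁h
  have hball : x₁ ∈ ball x₀ ρ := by
    rw [mem_ball]
    refine lt_of_le_of_ne (mem_closedBall.1 hx₁) fun hs => ?_
    have := hlat x₁ hs t₁ ht₁
    have h3 := (abs_le.1 (hlin x₁ hx₁)).1
    simp only [φ] at heq
    linarith
  have hline : ∀ ξ : EuclideanSpace ℝ (Fin n), ∀ᶠ s : ℝ in nhds 0,
      x₁ + s • ξ ∈ ball x₀ ρ := by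
    intro ξ
    have : ContinuousAt (fun s : ℝ => x₁ + s • ξ) 0 := by fun_prop
    exact this.eventually_mem (by simpa using isOpen_ball.mem_nhds hball)
  have hcurve : ∀ (ξ : EuclideanSpace ℝ (Fin n)) (s : ℝ),
      HasDerivAt (fun s : ℝ => ((x₁ + s • ξ, t₁) : SpaceTime n)) (ξ, 0) s := by
    intro ξ s
    refine HasDerivAt.prodMk ?_ (hasDerivAt_const _ _)
    simpa using ((hasDerivAt_id s).smul_const ξ).const_add x₁
  have hmaxξ : ∀ ξ : EuclideanSpace ℝ (Fin n),
      IsLocalMax (fun s : ℝ => φ (x₁ + s • ξ, t₁)) 0 := by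
    intro ξ
    filter_upwards [hline ξ] with s hs
    simpa [heq] using hle _ (ball_subset_closedBall hs)
  have hd1 : ∀ ξ : EuclideanSpace ℝ (Fin n), ∀ᶠ s : ℝ in nhds 0,
      HasDerivAt (fun s : ℝ => φ (x₁ + s • ξ, t₁))
        (∑ i, (g i (x₁ + s • ξ, t₁) - p i) * ξ i) s := by
    intro ξ
    filter_upwards [hline ξ] with s hs
    have := (hφd (x₁ + s • ξ, t₁) ⟨ball_subset_closedBall hs, ht₁⟩).comp_hasDerivAt s (hcurve ξ s)
    simpa using! this
  have hgp : ∀ i, g i (x₁, t₁) = p i := by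
    intro i
    have h1 := (hmaxξ (EuclideanSpace.single i (1 : ℝ))).hasDerivAt_eq_zero
      (hd1 (EuclideanSpace.single i (1 : ℝ))).self_of_nhds
    simp at h1
    linarith
  have hsec : ∀ ξ : Fin n → ℝ, ∑ i, ∑ j, H (x₁, t₁) i j * ξ i * ξ j ≤ 0 := by
    intro ξ'
    set ξ : EuclideanSpace ℝ (Fin n) := WithLp.toLp 2 ξ' with hξ
    have h2 : HasDerivAt (fun s : ℝ => ∑ i, (g i (x₁ + s • ξ, t₁) - p i) * ξ i)
        (∑ i, (∑ j, H (x₁, t₁) i j * ξ j) * ξ i) 0 := by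
      refine HasDerivAt.fun_sum fun i _ => HasDerivAt.mul_const (HasDerivAt.sub_const _ ?_) _
      have h3 := hg (x₁, t₁) hX₁ i
      rw [show ((x₁, t₁) : SpaceTime n) = (x₁ + (0 : ℝ) • ξ, t₁) by simp] at h3
      have := h3.comp_hasDerivAt 0 (hcurve ξ 0)
      simpa using! this
    have h3 := second_deriv_nonpos_of_isLocalMax (hmaxξ ξ) (hd1 ξ) h2
    refine le_of_eq_of_le (Finset.sum_congr rfl fun i _ => ?_) h3
    rw [Finset.sum_mul]
    exact Finset.sum_congr rfl fun j _ => by simp only [hξ]; ring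
  have hβ : 0 ≤ β (x₁, t₁) := by
    have hc : HasDerivAt (fun t : ℝ => ((x₁, t) : SpaceTime n)) (0, 1) t₁ :=
      (hasDerivAt_const _ _).prodMk (hasDerivAt_id t₁)
    have h1 : HasDerivAt (fun t => φ (x₁, t)) (β (x₁, t₁)) t₁ := by
      have := (hφd (x₁, t₁) hX₁).comp_hasDerivAt t₁ hc
      simpa using! this
    exact deriv_nonneg_of_le_left hat₁ h1 fun t ht => by
      rw [heq]; exact (hlt x₁ hx₁ t ht).le
  have hvx : v (x₁, t₁) = h + ∑ i, p i * (x₁ i - x₀ i) := by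
    simp only [φ] at heq
    linarith
  refine ⟨(x₁, t₁), ⟨hX₁, ?_, hβ, hsec⟩, ?_⟩
  · have h3 := (abs_le.1 (hlin x₁ hx₁)).1
    linarith
  · refine Prod.ext ?_ ?_
    · simp only [legendreMap, hgp]
      exact sum_smul_single p
    · simp only [legendreMap, hgp, hvx]
      ring

/-- The Krylov–Tso estimate. -/
theorem volume_cone_le_lintegral_contactSet {n : ℕ} {x₀ : EuclideanSpace ℝ (Fin n)}
    {ρ a b M : ℝ} (hρ : 0 < ρ)
    (hab : a ≤ b) {v : SpaceTime n → ℝ} {g : Fin n → SpaceTime n → ℝ}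
    {H : SpaceTime n → Matrix (Fin n) (Fin n) ℝ} {k : Fin n → SpaceTime n → ℝ}
    {β : SpaceTime n → ℝ}
    (hv : ∀ X ∈ closedBall x₀ ρ ×ˢ Icc a b, HasFDerivAt v (∑ i, g i X • dx i + β X • dt) X)
    (hg : ∀ X ∈ closedBall x₀ ρ ×ˢ Icc a b, ∀ i,
      HasFDerivAt (g i) (∑ j, H X i j • dx j + k i X • dt) X)
    (hβ : ContinuousOn β (closedBall x₀ ρ ×ˢ Icc a b))
    (hH : ∀ i j, ContinuousOn (fun X => H X i j) (closedBall x₀ ρ ×ˢ Icc a b))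
    (hbot : ∀ x ∈ closedBall x₀ ρ, v (x, a) ≤ 0)
    (hlat : ∀ x ∈ sphere x₀ ρ, ∀ t ∈ Icc a b, v (x, t) ≤ 0)
    (hM : M ≤ v (x₀, b)) :
    volume (ball (0 : EuclideanSpace ℝ (Fin n)) (M / (2 * ρ))) * ENNReal.ofReal (M / 2) ≤
      ∫⁻ X in contactSet (closedBall x₀ ρ ×ˢ Icc a b) v β H,
        ENNReal.ofReal |(H X).det * β X| := by
  set K := closedBall x₀ ρ ×ˢ Icc a b with hK
  have hKc : IsClosed K := isClosed_closedBall.prod isClosed_Icc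
  set Γ := contactSet K v β H with hΓ
  have hΓm : MeasurableSet Γ := (isClosed_contactSet hKc
    (fun X hX => (hv X hX).continuousAt.continuousWithinAt) hβ hH).measurableSet
  have hex : ∀ X, ∃ L : SpaceTime n →L[ℝ] SpaceTime n, X ∈ K →
      HasFDerivAt (legendreMap x₀ v g) L X ∧ L.det = (H X).det * β X := by
    intro X
    by_cases hX : X ∈ K
    · obtain ⟨L, hL⟩ := exists_hasFDerivAt_legendreMap (x₀ := x₀) (hv X hX) (hg X hX)
      exact ⟨L, fun _ => hL⟩
    · exact ⟨0, fun h => absurd h hX⟩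
  choose L hL using hex
  -- A cylinder inscribed in the cone `‖p‖ρ < h < M`; the lost constant is harmless.
  have hsub : ball (0 : EuclideanSpace ℝ (Fin n)) (M / (2 * ρ)) ×ˢ Ioo (M / 2) M ⊆
      legendreMap x₀ v g '' Γ := by
    rintro ⟨p, h⟩ ⟨hp, hh⟩
    refine mem_legendreMap_image hρ hab hv hg hbot hlat hM ?_ hh.2
    have hp' : ‖p‖ < M / (2 * ρ) := by simpa using hp
    have : ‖p‖ * ρ < M / (2 * ρ) * ρ := by gcongr
    have h2 : M / (2 * ρ) * ρ = M / 2 := by field_simp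
    exact (h2 ▸ this).trans hh.1
  have : (volume : Measure (SpaceTime n)).IsAddHaarMeasure :=
    inferInstanceAs ((volume : Measure (EuclideanSpace ℝ (Fin n))).prod
      (volume : Measure ℝ)).IsAddHaarMeasure
  calc _ = volume (ball (0 : EuclideanSpace ℝ (Fin n)) (M / (2 * ρ)) ×ˢ Ioo (M / 2) M) := by
        rw [Measure.volume_eq_prod, Measure.prod_prod, Real.volume_Ioo]
        congr 2
        ring
    _ ≤ volume (legendreMap x₀ v g '' Γ) := measure_mono hsub
    _ ≤ ∫⁻ X in Γ, ENNReal.ofReal |(L X).det| :=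
        addHaar_image_le_lintegral_abs_det_fderiv volume hΓm
          fun X hX => (hL X hX.1).1.hasFDerivWithinAt
    _ = _ := by
        refine setLIntegral_congr_fun hΓm fun X hX => ?_
        beta_reduce
        rw [(hL X hX.1).2]

/-! ### Averages in time -/

/-- The Steklov average `ε⁻¹ ∫_t^{t+ε} f(x,τ) dτ`. -/
noncomputable def steklov {n : ℕ} (ε : ℝ) (f : SpaceTime n → ℝ) (X : SpaceTime n) : ℝ :=
  ∫ σ in (0 : ℝ)..1, f (X.1, X.2 + ε * σ)

theorem shift_mem {n : ℕ} {U : Set (EuclideanSpace ℝ (Fin n))} {s₀ s₁ ε : ℝ} (hε : 0 < ε)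
    {X : SpaceTime n} (hX : X ∈ U ×ˢ Ioo s₀ (s₁ - ε)) {σ : ℝ} (hσ : σ ∈ Icc (0 : ℝ) 1) :
    ((X.1, X.2 + ε * σ) : SpaceTime n) ∈ U ×ˢ Ioo s₀ s₁ := by
  refine ⟨hX.1, ?_, ?_⟩
  · have := mul_nonneg hε.le hσ.1
    have := hX.2.1
    simp only
    linarith
  · have := mul_le_mul_of_nonneg_left hσ.2 hε.le
    have := hX.2.2
    simp only
    linarith

theorem continuousOn_shift {n : ℕ} {U : Set (EuclideanSpace ℝ (Fin n))} {s₀ s₁ ε : ℝ} (hε : 0 < ε)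
    {f : SpaceTime n → ℝ} (hf : ContinuousOn f (U ×ˢ Ioo s₀ s₁))
    {X : SpaceTime n} (hX : X ∈ U ×ˢ Ioo s₀ (s₁ - ε)) :
    ContinuousOn (fun σ : ℝ => f (X.1, X.2 + ε * σ)) (Icc 0 1) :=
  hf.comp (by fun_prop) fun _ hσ => shift_mem hε hX hσ

theorem intervalIntegrable_shift {n : ℕ} {U : Set (EuclideanSpace ℝ (Fin n))} {s₀ s₁ ε : ℝ}
    (hε : 0 < ε) {f : SpaceTime n → ℝ} (hf : ContinuousOn f (U ×ˢ Ioo s₀ s₁))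
    {X : SpaceTime n} (hX : X ∈ U ×ˢ Ioo s₀ (s₁ - ε)) :
    IntervalIntegrable (fun σ : ℝ => f (X.1, X.2 + ε * σ)) volume 0 1 := by
  apply ContinuousOn.intervalIntegrable
  rw [uIcc_of_le zero_le_one]
  exact continuousOn_shift hε hf hX

theorem continuousOn_steklov {n : ℕ} {U : Set (EuclideanSpace ℝ (Fin n))} {s₀ s₁ ε : ℝ}
    (hε : 0 < ε) {f : SpaceTime n → ℝ} (hf : ContinuousOn f (U ×ˢ Ioo s₀ s₁)) :
    ContinuousOn (steklov ε f) (U ×ˢ Ioo s₀ (s₁ - ε)) := by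
  rw [continuousOn_iff_continuous_domRestrict]
  let F : (U ×ˢ Ioo s₀ (s₁ - ε) : Set (SpaceTime n)) → ℝ → ℝ := fun X σ =>
    f (X.1.1, X.1.2 + ε * (projIcc (0 : ℝ) 1 zero_le_one σ : ℝ))
  have hF : Continuous F.uncurry := by
    refine hf.comp_continuous
      (f := fun p : (U ×ˢ Ioo s₀ (s₁ - ε) : Set (SpaceTime n)) × ℝ =>
        (p.1.1.1, p.1.1.2 + ε * (projIcc (0 : ℝ) 1 zero_le_one p.2 : ℝ))) ?_ ?_
    · have := continuous_projIcc (a := (0 : ℝ)) (b := 1) (h := zero_le_one)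
      fun_prop
    · exact fun p => shift_mem hε p.1.2 (projIcc (0 : ℝ) 1 zero_le_one p.2).2
  refine (intervalIntegral.continuous_parametric_intervalIntegral_of_continuous' (μ := volume)
    hF 0 1).congr fun X => ?_
  refine intervalIntegral.integral_congr fun σ hσ => ?_
  rw [uIcc_of_le zero_le_one] at hσ
  simp only [F, projIcc_of_mem zero_le_one hσ]

theorem hasLineDerivAt_steklov {n : ℕ} {U : Set (EuclideanSpace ℝ (Fin n))} (hU : IsOpen U)
    {s₀ s₁ ε : ℝ} (hε : 0 < ε) {f df : SpaceTime n → ℝ} {e : EuclideanSpace ℝ (Fin n)}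
    (hf : ContinuousOn f (U ×ˢ Ioo s₀ s₁)) (hdf : ContinuousOn df (U ×ˢ Ioo s₀ s₁))
    (hd : ∀ X ∈ U ×ˢ Ioo s₀ s₁, HasLineDerivAt ℝ (fun x => f (x, X.2)) (df X) X.1 e)
    {X : SpaceTime n} (hX : X ∈ U ×ˢ Ioo s₀ (s₁ - ε)) :
    HasLineDerivAt ℝ (fun x => steklov ε f (x, X.2)) (steklov ε df X) X.1 e := by
  have hcurve : Continuous fun s : ℝ => X.1 + s • e := by fun_prop
  obtain ⟨δ, hδ, hball⟩ := Metric.isOpen_iff.1 (hU.preimage hcurve) 0 (by simpa using hX.1)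
  have hmem : ∀ s ∈ closedBall (0 : ℝ) (δ / 2),
      ((X.1 + s • e, X.2) : SpaceTime n) ∈ U ×ˢ Ioo s₀ (s₁ - ε) := fun s hs =>
    ⟨hball (closedBall_subset_ball (by linarith) hs), hX.2⟩
  have hc : ContinuousOn (fun p : ℝ × ℝ => df (X.1 + p.1 • e, X.2 + ε * p.2))
      (closedBall (0 : ℝ) (δ / 2) ×ˢ Icc (0 : ℝ) 1) :=
    hdf.comp (by fun_prop) fun p hp => shift_mem hε (hmem p.1 hp.1) hp.2
  obtain ⟨C, hC⟩ := ((isCompact_closedBall _ _).prod isCompact_Icc).exists_bound_of_continuousOn hc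
  have hIoc : uIoc (0 : ℝ) 1 = Ioc 0 1 := uIoc_of_le zero_le_one
  have hnhds : closedBall (0 : ℝ) (δ / 2) ∈ nhds (0 : ℝ) := closedBall_mem_nhds _ (by linarith)
  have hX0 : ((X.1 + (0 : ℝ) • e, X.2) : SpaceTime n) ∈ U ×ˢ Ioo s₀ (s₁ - ε) := by simpa using hX
  have key := intervalIntegral.hasDerivAt_integral_of_dominated_loc_of_deriv_le
    (F := fun s σ => f (X.1 + s • e, X.2 + ε * σ))
    (F' := fun s σ => df (X.1 + s • e, X.2 + ε * σ)) (x₀ := (0 : ℝ)) (a := 0) (b := 1)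
    (μ := volume) (bound := fun _ => C) (isOpen_ball.mem_nhds (mem_ball_self (half_pos hδ)))
    ?_ ?_ ?_ ?_ ?_ ?_
  · simpa [HasLineDerivAt, steklov] using! key.2
  · filter_upwards [hnhds] with s hs
    rw [hIoc]
    exact (intervalIntegrable_shift hε hf (hmem s hs)).1.aestronglyMeasurable
  · exact intervalIntegrable_shift hε hf hX0
  · rw [hIoc]
    exact (intervalIntegrable_shift hε hdf hX0).1.aestronglyMeasurable
  · refine Filter.Eventually.of_forall fun σ hσ s hs => ?_
    rw [hIoc] at hσ
    exact hC (s, σ) ⟨ball_subset_closedBall hs, hσ.1.le, hσ.2⟩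
  · exact intervalIntegrable_const
  · refine Filter.Eventually.of_forall fun σ hσ s hs => ?_
    rw [hIoc] at hσ
    have h1 : HasLineDerivAt ℝ (fun x => f (x, X.2 + ε * σ))
        (df (X.1 + s • e, X.2 + ε * σ)) (X.1 + s • e) e :=
      hd _ (shift_mem hε (hmem s (ball_subset_closedBall hs)) ⟨hσ.1.le, hσ.2⟩)
    have h2 : HasDerivAt (fun s' : ℝ => s' - s) 1 s := (hasDerivAt_id s).sub_const s
    have h3 := HasDerivAt.comp s (by simpa [HasLineDerivAt] using h1) h2
    simp only [mul_one] at h3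
    refine h3.congr_of_eventuallyEq (Filter.Eventually.of_forall fun s' => ?_)
    simp only [Function.comp]
    congr 2
    rw [sub_smul]
    abel

/-- After rescaling, the average is `ε⁻¹ ∫_t^(t+ε)`, and the fundamental theorem of calculus
applies. Continuity of `f` suffices, so averaged spatial gradients become differentiable in time. -/
theorem hasDerivAt_steklov_time {n : ℕ} {U : Set (EuclideanSpace ℝ (Fin n))}
    {s₀ s₁ ε : ℝ} (hε : 0 < ε) {f : SpaceTime n → ℝ}
    (hf : ContinuousOn f (U ×ˢ Ioo s₀ s₁))
    {X : SpaceTime n} (hX : X ∈ U ×ˢ Ioo s₀ (s₁ - ε)) :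
    HasDerivAt (fun t => steklov ε f (X.1, t)) (ε⁻¹ * (f (X.1, X.2 + ε) - f X)) X.2 := by
  obtain ⟨x, t⟩ := X
  have ht : t ∈ Ioo s₀ (s₁ - ε) := hX.2
  have hfx : ContinuousOn (fun τ => f (x, τ)) (Ioo s₀ s₁) :=
    hf.comp (by fun_prop) fun τ hτ => ⟨hX.1, hτ⟩
  have hint : ∀ {a b}, a ∈ Ioo s₀ s₁ → b ∈ Ioo s₀ s₁ →
      IntervalIntegrable (fun τ => f (x, τ)) volume a b := fun ha hb =>
    (hfx.mono (ordConnected_Ioo.uIcc_subset ha hb)).intervalIntegrable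
  have ht1 : t ∈ Ioo s₀ s₁ := ⟨ht.1, by linarith [ht.2]⟩
  have ht2 : t + ε ∈ Ioo s₀ s₁ := ⟨by linarith [ht.1], by linarith [ht.2]⟩
  have hder : ∀ b ∈ Ioo s₀ s₁, HasDerivAt (fun s => ∫ τ in t..s, f (x, τ)) (f (x, b)) b :=
    fun b hb => intervalIntegral.integral_hasDerivAt_right (hint ht1 hb)
      (hfx.stronglyMeasurableAtFilter isOpen_Ioo b hb) (hfx.continuousAt (isOpen_Ioo.mem_nhds hb))
  have h1 : HasDerivAt (fun s => ∫ τ in t..(s + ε), f (x, τ)) (f (x, t + ε)) t := by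
    have h2 : HasDerivAt (fun s : ℝ => s + ε) 1 t := (hasDerivAt_id t).add_const ε
    simpa using! (hder _ ht2).comp t h2
  have h3 := (h1.sub (hder t ht1)).const_mul ε⁻¹
  refine h3.congr_of_eventuallyEq ?_
  filter_upwards [isOpen_Ioo.mem_nhds ht] with s hs
  have hs1 : s ∈ Ioo s₀ s₁ := ⟨hs.1, by linarith [hs.2]⟩
  have hs2 : s + ε ∈ Ioo s₀ s₁ := ⟨by linarith [hs.1], by linarith [hs.2]⟩
  have e1 := intervalIntegral.integral_comp_add_mul (fun τ => f (x, τ)) hε.ne' s (a := 0) (b := 1)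
  simp only [mul_zero, add_zero, mul_one, smul_eq_mul] at e1
  simp only [steklov, Pi.sub_apply]
  rw [e1, intervalIntegral.integral_interval_sub_left (hint ht1 hs2) (hint ht1 hs1)]

theorem abs_steklov_sub_le {n : ℕ} {U : Set (EuclideanSpace ℝ (Fin n))}
    {s₀ s₁ ε δ : ℝ} (hε : 0 < ε) {f : SpaceTime n → ℝ}
    (hf : ContinuousOn f (U ×ˢ Ioo s₀ s₁))
    {X : SpaceTime n} (hX : X ∈ U ×ˢ Ioo s₀ (s₁ - ε))
    (h : ∀ σ ∈ Icc (0 : ℝ) 1, |f (X.1, X.2 + ε * σ) - f X| ≤ δ) :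
    |steklov ε f X - f X| ≤ δ := by
  have e : steklov ε f X - f X = ∫ σ in (0 : ℝ)..1, (f (X.1, X.2 + ε * σ) - f X) := by
    rw [intervalIntegral.integral_sub (intervalIntegrable_shift hε hf hX) intervalIntegrable_const]
    simp [steklov]
  rw [e]
  have := intervalIntegral.norm_integral_le_of_norm_le_const (a := (0 : ℝ)) (b := 1) (C := δ)
    (f := fun σ => f (X.1, X.2 + ε * σ) - f X) (fun σ hσ => h σ (by
      rw [uIoc_of_le zero_le_one] at hσ
      exact ⟨hσ.1.le, hσ.2⟩))
  simpa using this

/-- By the mean value theorem the difference quotient is a value of `ft` at an intermediate time. -/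
theorem abs_differenceQuotient_sub_le {n : ℕ} {U : Set (EuclideanSpace ℝ (Fin n))}
    {s₀ s₁ ε δ : ℝ} (hε : 0 < ε) {f ft : SpaceTime n → ℝ}
    (hf : ∀ X ∈ U ×ˢ Ioo s₀ s₁, HasDerivAt (fun t => f (X.1, t)) (ft X) X.2)
    {X : SpaceTime n} (hX : X ∈ U ×ˢ Ioo s₀ (s₁ - ε))
    (h : ∀ σ ∈ Icc (0 : ℝ) 1, |ft (X.1, X.2 + ε * σ) - ft X| ≤ δ) :
    |ε⁻¹ * (f (X.1, X.2 + ε) - f X) - ft X| ≤ δ := by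
  have hd : ∀ σ ∈ Icc (0 : ℝ) 1, HasDerivAt (fun σ => f (X.1, X.2 + ε * σ))
      (ft (X.1, X.2 + ε * σ) * ε) σ := by
    intro σ hσ
    have h1 : HasDerivAt (fun σ : ℝ => X.2 + ε * σ) ε σ := by
      simpa using ((hasDerivAt_id σ).const_mul ε).const_add X.2
    exact HasDerivAt.comp σ (hf _ (shift_mem hε hX hσ)) h1
  obtain ⟨σ, hσ, hc⟩ := exists_hasDerivAt_eq_slope (fun σ => f (X.1, X.2 + ε * σ))
    (fun σ => ft (X.1, X.2 + ε * σ) * ε) zero_lt_one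
    (fun σ hσ => (hd σ hσ).continuousAt.continuousWithinAt)
    (fun σ hσ => hd σ (Ioo_subset_Icc_self hσ))
  have e : ε⁻¹ * (f (X.1, X.2 + ε) - f X) = ft (X.1, X.2 + ε * σ) := by
    simp only [mul_one, mul_zero, add_zero, sub_zero, div_one] at hc
    have e2 : ((X.1, X.2) : SpaceTime n) = X := rfl
    rw [e2] at hc
    rw [← hc]
    field_simp
  rw [e]
  exact h σ (Ioo_subset_Icc_self hσ)

theorem eventually_shift_close {n : ℕ} {x₀ : EuclideanSpace ℝ (Fin n)} {ρ a b c δ : ℝ}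
    (hbc : b < c) (hδ : 0 < δ) {f : SpaceTime n → ℝ}
    (hf : ContinuousOn f (closedBall x₀ ρ ×ˢ Icc a c)) :
    ∀ᶠ ε in nhdsWithin (0 : ℝ) (Ioi 0), ∀ X ∈ closedBall x₀ ρ ×ˢ Icc a b,
      ∀ σ ∈ Icc (0 : ℝ) 1, |f (X.1, X.2 + ε * σ) - f X| ≤ δ := by
  have huc := ((isCompact_closedBall x₀ ρ).prod
    (isCompact_Icc (a := a) (b := c))).uniformContinuousOn_of_continuous hf
  obtain ⟨η, hη, hclose⟩ := Metric.uniformContinuousOn_iff.1 huc δ hδ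
  have hlt : 0 < min η (c - b) := lt_min hη (by linarith)
  filter_upwards [Ioo_mem_nhdsGT hlt] with ε hε X hX σ hσ
  have h1 : ε * σ ≤ ε := mul_le_of_le_one_right hε.1.le hσ.2
  have h2 : 0 ≤ ε * σ := mul_nonneg hε.1.le hσ.1
  have h3 := hε.2.trans_le (min_le_left _ _)
  have h4 := hε.2.trans_le (min_le_right _ _)
  have h5 := hX.2.1
  have h6 := hX.2.2
  have := hclose (X.1, X.2 + ε * σ) ⟨hX.1, by simp only; linarith, by simp only; linarith⟩ X
    ⟨hX.1, h5, by linarith⟩ (by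
      rw [Prod.dist_eq]
      simp only [dist_self, Real.dist_eq, add_sub_cancel_left, abs_of_nonneg h2]
      exact max_lt hη (by linarith))
  exact (Real.dist_eq _ _ ▸ this).le

theorem hessian_symm_of_isC21On {n : ℕ} {U : Set (EuclideanSpace ℝ (Fin n))} (hU : IsOpen U)
    {s₀ s₁ : ℝ} {u : SpaceTime n → ℝ} (hu : IsC21On u (U ×ˢ Ioo s₀ s₁)) {X : SpaceTime n}
    (hX : X ∈ U ×ˢ Ioo s₀ s₁) (i j : Fin n) :
    spaceDeriv i (spaceDeriv j u) X = spaceDeriv j (spaceDeriv i u) X := by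
  have hslice : ∀ {f : SpaceTime n → ℝ}, ContinuousOn f (U ×ˢ Ioo s₀ s₁) →
      ContinuousOn (fun x => f (x, X.2)) U := fun hf =>
    hf.comp (by fun_prop) fun x hx => ⟨hx, hX.2⟩
  have h := hessian_symm (f := fun x => u (x, X.2)) (g := fun i x => spaceDeriv i u (x, X.2))
    (H := Matrix.of fun i j => spaceDeriv j (spaceDeriv i u) X) (x := X.1) ?_ ?_
  · exact h.apply i j
  · filter_upwards [hU.mem_nhds hX.1] with z hz
    exact hasFDerivAt_space hU
      (fun i x hx => (hu.space_exists i (x, X.2) ⟨hx, hX.2⟩).hasLineDerivAt)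
      (fun i => hslice (hu.space_continuousOn i)) hz
  · intro i
    exact hasFDerivAt_space (df := fun j x => spaceDeriv j (spaceDeriv i u) (x, X.2)) hU
      (fun j x hx => (hu.space₂_exists j i (x, X.2) ⟨hx, hX.2⟩).hasLineDerivAt)
      (fun j => hslice (hu.space₂_continuousOn j i)) hX.1

/-- A `C^{2,1}` function is approximated, with its derivatives `u_t` and `D_{ij} u`, by functions
whose gradient is differentiable in space and time. -/
theorem exists_approx_of_isC21On {n : ℕ} {U : Set (EuclideanSpace ℝ (Fin n))} (hU : IsOpen U)
    {s₀ s₁ : ℝ} {u : SpaceTime n → ℝ} (hu : IsC21On u (U ×ˢ Ioo s₀ s₁))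
    {x₀ : EuclideanSpace ℝ (Fin n)} {ρ a b δ : ℝ} (hball : closedBall x₀ ρ ⊆ U) (ha : s₀ < a)
    (hb : b < s₁) (hδ : 0 < δ) :
    ∃ (v : SpaceTime n → ℝ) (g k : Fin n → SpaceTime n → ℝ)
      (H : SpaceTime n → Matrix (Fin n) (Fin n) ℝ) (β : SpaceTime n → ℝ),
      (∀ X ∈ closedBall x₀ ρ ×ˢ Icc a b, HasFDerivAt v (∑ i, g i X • dx i + β X • dt) X) ∧
      (∀ X ∈ closedBall x₀ ρ ×ˢ Icc a b, ∀ i,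
        HasFDerivAt (g i) (∑ j, H X i j • dx j + k i X • dt) X) ∧
      ContinuousOn β (closedBall x₀ ρ ×ˢ Icc a b) ∧
      (∀ i j, ContinuousOn (fun X => H X i j) (closedBall x₀ ρ ×ˢ Icc a b)) ∧
      ∀ X ∈ closedBall x₀ ρ ×ˢ Icc a b, |v X - u X| ≤ δ ∧ |β X - timeDeriv u X| ≤ δ ∧
        (H X).IsSymm ∧ ∀ i j, |H X i j - spaceDeriv i (spaceDeriv j u) X| ≤ δ := by
  -- The averages look forward in time; the interval from `b` to `c` is room for the shift inside a
  -- compact set, where uniform continuity holds.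
  obtain ⟨c, hbc, hc⟩ := exists_between hb
  have hsub : closedBall x₀ ρ ×ˢ Icc a c ⊆ U ×ˢ Ioo s₀ s₁ :=
    prod_mono hball fun t ht => ⟨ha.trans_le ht.1, ht.2.trans_lt hc⟩
  have hev : ∀ᶠ ε in nhdsWithin (0 : ℝ) (Ioi 0), ∀ i j, ∀ X ∈ closedBall x₀ ρ ×ˢ Icc a b,
      ∀ σ ∈ Icc (0 : ℝ) 1, |spaceDeriv i (spaceDeriv j u) (X.1, X.2 + ε * σ)
        - spaceDeriv i (spaceDeriv j u) X| ≤ δ :=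
    Filter.eventually_all.2 fun i => Filter.eventually_all.2 fun j =>
      eventually_shift_close hbc hδ ((hu.space₂_continuousOn i j).mono hsub)
  have hsmall : Ioo (0 : ℝ) (s₁ - b) ∈ nhdsWithin (0 : ℝ) (Ioi 0) := Ioo_mem_nhdsGT (by linarith)
  obtain ⟨ε, hε1, hε2, hε3, hε0, hεb⟩ := ((eventually_shift_close hbc hδ
    (hu.continuousOn.mono hsub)).and ((eventually_shift_close hbc hδ
    (hu.time_continuousOn.mono hsub)).and (hev.and hsmall))).exists
  have hKsub : closedBall x₀ ρ ×ˢ Icc a b ⊆ U ×ˢ Ioo s₀ (s₁ - ε) :=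
    prod_mono hball fun t ht => ⟨ha.trans_le ht.1, by linarith [ht.2]⟩
  have hΩ : IsOpen (U ×ˢ Ioo s₀ (s₁ - ε)) := hU.prod isOpen_Ioo
  have hquot : ∀ {f : SpaceTime n → ℝ}, ContinuousOn f (U ×ˢ Ioo s₀ s₁) →
      ContinuousOn (fun X : SpaceTime n => ε⁻¹ * (f (X.1, X.2 + ε) - f X))
        (U ×ˢ Ioo s₀ (s₁ - ε)) := by
    intro f hf
    refine continuousOn_const.mul (ContinuousOn.sub (hf.comp (by fun_prop) fun X hX => ?_)
      (hf.mono (prod_mono_right (Ioo_subset_Ioo_right (by linarith)))))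
    simpa using shift_mem hε0 hX (right_mem_Icc.2 zero_le_one)
  have hcS : ∀ {f : SpaceTime n → ℝ}, ContinuousOn f (U ×ˢ Ioo s₀ s₁) →
      ContinuousOn (steklov ε f) (U ×ˢ Ioo s₀ (s₁ - ε)) := fun hf => continuousOn_steklov hε0 hf
  refine ⟨steklov ε u, fun i => steklov ε (spaceDeriv i u),
    fun i X => ε⁻¹ * (spaceDeriv i u (X.1, X.2 + ε) - spaceDeriv i u X),
    fun X => Matrix.of fun i j => steklov ε (spaceDeriv j (spaceDeriv i u)) X,
    fun X => ε⁻¹ * (u (X.1, X.2 + ε) - u X), ?_, ?_, ?_, ?_, ?_⟩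
  · intro X hX
    exact hasFDerivAt_spaceTime (df := fun i => steklov ε (spaceDeriv i u)) hΩ
      (fun i Z hZ => hasLineDerivAt_steklov hU hε0 hu.continuousOn (hu.space_continuousOn i)
        (fun W hW => (hu.space_exists i W hW).hasLineDerivAt) hZ)
      (fun Z hZ => hasDerivAt_steklov_time hε0 hu.continuousOn hZ)
      (fun i => hcS (hu.space_continuousOn i)) (hquot hu.continuousOn) (hKsub hX)
  · intro X hX i
    exact hasFDerivAt_spaceTime (df := fun j => steklov ε (spaceDeriv j (spaceDeriv i u))) hΩ
      (fun j Z hZ => hasLineDerivAt_steklov hU hε0 (hu.space_continuousOn i)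
        (hu.space₂_continuousOn j i) (fun W hW => (hu.space₂_exists j i W hW).hasLineDerivAt) hZ)
      (fun Z hZ => hasDerivAt_steklov_time hε0 (hu.space_continuousOn i) hZ)
      (fun j => hcS (hu.space₂_continuousOn j i)) (hquot (hu.space_continuousOn i)) (hKsub hX)
  · exact (hquot hu.continuousOn).mono hKsub
  · exact fun i j => (hcS (hu.space₂_continuousOn j i)).mono hKsub
  · intro X hX
    have hsymm : ∀ i j, steklov ε (spaceDeriv j (spaceDeriv i u)) X
        = steklov ε (spaceDeriv i (spaceDeriv j u)) X := by
      intro i j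
      refine intervalIntegral.integral_congr fun σ hσ => ?_
      rw [uIcc_of_le zero_le_one] at hσ
      exact hessian_symm_of_isC21On hU hu (shift_mem hε0 (hKsub hX) hσ) j i
    refine ⟨abs_steklov_sub_le hε0 hu.continuousOn (hKsub hX) (hε1 X hX),
      abs_differenceQuotient_sub_le hε0
        (fun Z hZ => (hu.time_exists Z hZ).hasDerivAt) (hKsub hX) (hε2 X hX), ?_, fun i j => ?_⟩
    · ext i j
      exact hsymm j i
    · change |steklov ε (spaceDeriv j (spaceDeriv i u)) X - _| ≤ δ
      rw [hsymm]
      exact abs_steklov_sub_le hε0 (hu.space₂_continuousOn i j) (hKsub hX) (hε3 i j X hX)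

/-! ### Muckenhoupt weights -/

theorem mu_nonneg {n : ℕ} {ω : EuclideanSpace ℝ (Fin n) → ℝ} (hω : ∀ x, 0 ≤ ω x)
    (x : EuclideanSpace ℝ (Fin n)) : 0 ≤ mu ω x := inv_nonneg.2 (pow_nonneg (hω x) n)

theorem IsMuckenhoupt.integrableOn_ball {n : ℕ} {p : ℝ} {ω : EuclideanSpace ℝ (Fin n) → ℝ}
    (h : IsMuckenhoupt p ω) (x : EuclideanSpace ℝ (Fin n)) (ρ : ℝ) :
    IntegrableOn ω (ball x ρ) :=
  (h.locallyIntegrable.integrableOn_isCompact (isCompact_closedBall x ρ)).mono_set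
    ball_subset_closedBall

theorem IsMuckenhoupt.aestronglyMeasurable_mu {n : ℕ} {p : ℝ}
    {ω : EuclideanSpace ℝ (Fin n) → ℝ}
    (h : IsMuckenhoupt p ω) : AEStronglyMeasurable (mu ω) volume :=
  ((h.locallyIntegrable.aestronglyMeasurable.aemeasurable.pow_const n).inv).aestronglyMeasurable

theorem volume_real_ball_pos {n : ℕ} (x : EuclideanSpace ℝ (Fin n)) {ρ : ℝ} (hρ : 0 < ρ) :
    0 < volume.real (ball x ρ) :=
  ENNReal.toReal_pos (measure_ball_pos _ _ hρ).ne' measure_ball_lt_top.ne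

theorem setIntegral_ball_pos {n : ℕ} {f : EuclideanSpace ℝ (Fin n) → ℝ}
    (hf : ∀ᵐ x, 0 < f x) {x : EuclideanSpace ℝ (Fin n)} {ρ : ℝ} (hρ : 0 < ρ)
    (hi : IntegrableOn f (ball x ρ)) : 0 < ∫ z in ball x ρ, f z := by
  have hf' : ∀ᵐ z ∂volume.restrict (ball x ρ), 0 < f z := ae_restrict_of_ae hf
  rw [integral_pos_iff_support_of_nonneg_ae (hf'.mono fun z hz => hz.le) hi]
  have : volume.restrict (ball x ρ) (Function.support f) = volume.restrict (ball x ρ) univ := by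
    apply measure_congr
    filter_upwards [hf'] with z hz
    exact propext ⟨fun _ => trivial, fun _ => hz.ne'⟩
  rw [this, Measure.restrict_apply_univ]
  exact measure_ball_pos _ _ hρ

theorem setAverage_mul_volume {n : ℕ} (f : EuclideanSpace ℝ (Fin n) → ℝ)
    (x : EuclideanSpace ℝ (Fin n)) {ρ : ℝ} (hρ : 0 < ρ) :
    (⨍ z in ball x ρ, f z) * volume.real (ball x ρ) = ∫ z in ball x ρ, f z := by
  have := volume_real_ball_pos x hρ
  rw [setAverage_eq, smul_eq_mul]
  field_simp

theorem setAverage_ball_pos {n : ℕ} {f : EuclideanSpace ℝ (Fin n) → ℝ}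
    (hf : ∀ᵐ x, 0 < f x) {x : EuclideanSpace ℝ (Fin n)} {ρ : ℝ} (hρ : 0 < ρ)
    (hi : IntegrableOn f (ball x ρ)) : 0 < ⨍ z in ball x ρ, f z := by
  have h1 := setIntegral_ball_pos hf hρ hi
  rw [← setAverage_mul_volume f x hρ] at h1
  exact pos_of_mul_pos_left h1 (volume_real_ball_pos x hρ).le

theorem ofReal_setAverage_ball {n : ℕ} {f : EuclideanSpace ℝ (Fin n) → ℝ}
    (hf : ∀ᵐ x, 0 < f x) {x : EuclideanSpace ℝ (Fin n)} {ρ : ℝ} (hρ : 0 < ρ)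
    (hi : IntegrableOn f (ball x ρ)) :
    ENNReal.ofReal (⨍ z in ball x ρ, f z) = ⨍⁻ z in ball x ρ, ENNReal.ofReal (f z) ∂volume := by
  rw [setLAverage_eq, ← ofReal_integral_eq_lintegral_ofReal hi
    (ae_restrict_of_ae (hf.mono fun z hz => hz.le)), ← setAverage_mul_volume f x hρ,
    ENNReal.ofReal_mul (setAverage_ball_pos hf hρ hi).le, ofReal_measureReal measure_ball_lt_top.ne,
    ENNReal.mul_div_cancel_right (measure_ball_pos _ _ hρ).ne' measure_ball_lt_top.ne]

theorem IsMuckenhoupt.mu_pos {n : ℕ} {p : ℝ} {ω : EuclideanSpace ℝ (Fin n) → ℝ}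
    (h : IsMuckenhoupt p ω) : ∀ᵐ x, 0 < mu ω x :=
  h.ae_pos.mono fun _ hx => inv_pos.2 (pow_pos hx n)

/-- The Muckenhoupt condition on a ball, in terms of `μ = ω^(-n)`. -/
theorem laverage_mul_laverage_mu_le {n : ℕ} (hn : 1 ≤ n) {K₀ : ℝ}
    {ω : EuclideanSpace ℝ (Fin n) → ℝ}
    (h : IsMuckenhoupt (1 + 1 / (n : ℝ)) ω)
    (hK : muckenhouptChar (1 + 1 / (n : ℝ)) ω ≤ ENNReal.ofReal K₀)
    (x : EuclideanSpace ℝ (Fin n)) {ρ : ℝ} (hρ : 0 < ρ) :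
    (⨍⁻ z in ball x ρ, ENNReal.ofReal (ω z) ∂volume) *
      (⨍⁻ z in ball x ρ, ENNReal.ofReal (mu ω z) ∂volume) ^ (1 / (n : ℝ)) ≤ ENNReal.ofReal K₀ := by
  refine le_trans ?_ hK
  have hn' : (0 : ℝ) < n := by exact_mod_cast hn
  have e : (⨍⁻ z in ball x ρ, ENNReal.ofReal (mu ω z) ∂volume)
      = ⨍⁻ z in ball x ρ, ENNReal.ofReal (ω z) ^ (-1 / ((1 + 1 / (n : ℝ)) - 1)) ∂volume := by
    refine laverage_congr (ae_restrict_of_ae (h.ae_pos.mono fun z hz => ?_))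
    have e1 : -1 / ((1 + 1 / (n : ℝ)) - 1) = -(n : ℝ) := by field_simp; ring
    beta_reduce
    rw [e1, ENNReal.ofReal_rpow_of_pos hz, Real.rpow_neg hz.le, Real.rpow_natCast]
    rfl
  have e2 : 1 / (n : ℝ) = (1 + 1 / (n : ℝ)) - 1 := by ring
  rw [e]
  refine le_trans (le_of_eq ?_) (le_iSup₂_of_le x ρ (le_iSup_of_le hρ le_rfl))
  congr 2

/-- The mean of `ω` is positive, so an infinite mean of `μ` would make the Muckenhoupt product
infinite. -/
theorem integrableOn_mu {n : ℕ} (hn : 1 ≤ n) {K₀ : ℝ} {ω : EuclideanSpace ℝ (Fin n) → ℝ}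
    (h : IsMuckenhoupt (1 + 1 / (n : ℝ)) ω)
    (hK : muckenhouptChar (1 + 1 / (n : ℝ)) ω ≤ ENNReal.ofReal K₀)
    (x : EuclideanSpace ℝ (Fin n)) {ρ : ℝ} (hρ : 0 < ρ) : IntegrableOn (mu ω) (ball x ρ) := by
  have h1 := laverage_mul_laverage_mu_le hn h hK x hρ
  have hn' : (0 : ℝ) < n := by exact_mod_cast hn
  have hω := h.integrableOn_ball x ρ
  rw [← ofReal_setAverage_ball h.ae_pos hρ hω] at h1
  refine ⟨h.aestronglyMeasurable_mu.restrict, ?_⟩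
  rw [hasFiniteIntegral_iff_ofReal (ae_restrict_of_ae (h.mu_pos.mono fun z hz => hz.le))]
  by_contra hcon
  rw [not_lt, top_le_iff] at hcon
  rw [setLAverage_eq (f := fun z => ENNReal.ofReal (mu ω z)), hcon,
    ENNReal.top_div_of_ne_top measure_ball_lt_top.ne, ENNReal.top_rpow_of_pos (by positivity),
    ENNReal.mul_top (by simpa using setAverage_ball_pos h.ae_pos hρ hω)] at h1
  exact ENNReal.ofReal_ne_top (top_le_iff.1 h1)

theorem setAverage_mul_setAverage_mu_le {n : ℕ} (hn : 1 ≤ n) {K₀ : ℝ} (hK₀ : 0 ≤ K₀)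
    {ω : EuclideanSpace ℝ (Fin n) → ℝ} (h : IsMuckenhoupt (1 + 1 / (n : ℝ)) ω)
    (hK : muckenhouptChar (1 + 1 / (n : ℝ)) ω ≤ ENNReal.ofReal K₀)
    (x : EuclideanSpace ℝ (Fin n)) {ρ : ℝ} (hρ : 0 < ρ) :
    (⨍ z in ball x ρ, ω z) * (⨍ z in ball x ρ, mu ω z) ^ (1 / (n : ℝ)) ≤ K₀ := by
  have h1 := laverage_mul_laverage_mu_le hn h hK x hρ
  have hω := h.integrableOn_ball x ρ
  have hμ := integrableOn_mu hn h hK x hρ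
  have hμ0 := setAverage_ball_pos h.mu_pos hρ hμ
  rwa [← ofReal_setAverage_ball h.ae_pos hρ hω, ← ofReal_setAverage_ball h.mu_pos hρ hμ,
    ENNReal.ofReal_rpow_of_pos hμ0, ← ENNReal.ofReal_mul (setAverage_ball_pos h.ae_pos hρ hω).le,
    ENNReal.ofReal_le_ofReal_iff hK₀] at h1

theorem lintegral_oscillation_le {n : ℕ} {p ε : ℝ} (hε : 0 ≤ ε)
    {ω : EuclideanSpace ℝ (Fin n) → ℝ} {Ω : Set (EuclideanSpace ℝ (Fin n))}
    (h : IsMuckenhoupt p ω) (hbmo : weightedBMO ω ω Ω ≤ ENNReal.ofReal ε)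
    {x : EuclideanSpace ℝ (Fin n)} {ρ : ℝ} (hρ : 0 < ρ) (hsub : ball x ρ ⊆ Ω) :
    ∫⁻ z in ball x ρ, ENNReal.ofReal (|ω z - ⨍ y in ball x ρ, ω y| ^ (n + 1) * mu ω z) ≤
      ENNReal.ofReal (ε ^ (n + 1) * ∫ z in ball x ρ, ω z) := by
  have h1 : weightedOsc ω ω x ρ ≤ ENNReal.ofReal ε :=
    le_trans (le_iSup₂_of_le x ρ (le_iSup_of_le hρ
      (le_iSup (fun _ : ball x ρ ⊆ Ω => weightedOsc ω ω x ρ) hsub))) hbmo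
  have hω := h.integrableOn_ball x ρ
  have hpos := setIntegral_ball_pos h.ae_pos hρ hω
  rw [weightedOsc, ← ofReal_integral_eq_lintegral_ofReal hω
    (ae_restrict_of_ae (h.ae_pos.mono fun z hz => hz.le)), one_div,
    ENNReal.rpow_inv_le_iff (by positivity),
    ENNReal.div_le_iff (by simpa using hpos) ENNReal.ofReal_ne_top] at h1
  have e : ENNReal.ofReal ε ^ ((n : ℝ) + 1) = ENNReal.ofReal (ε ^ (n + 1)) := by
    rw [ENNReal.ofReal_pow hε]
    exact_mod_cast ENNReal.rpow_natCast (ENNReal.ofReal ε) (n + 1)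
  rw [e, ← ENNReal.ofReal_mul (by positivity)] at h1
  refine le_of_eq_of_le (lintegral_congr_ae (ae_restrict_of_ae (h.ae_pos.mono fun z hz => ?_))) h1
  beta_reduce
  rw [ENNReal.ofReal_mul (by positivity), ENNReal.ofReal_pow (abs_nonneg _), mu,
    ENNReal.ofReal_inv_of_pos (by positivity), ENNReal.ofReal_pow hz.le]

/-- The doubling property of `μ`. -/
theorem setIntegral_mu_doubling {n : ℕ} (hn : 1 ≤ n) {K₀ : ℝ} (hK₀ : 0 ≤ K₀)
    {ω : EuclideanSpace ℝ (Fin n) → ℝ} (h : IsMuckenhoupt (1 + 1 / (n : ℝ)) ω)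
    (hK : muckenhouptChar (1 + 1 / (n : ℝ)) ω ≤ ENNReal.ofReal K₀)
    {x y : EuclideanSpace ℝ (Fin n)} {ρ r : ℝ} (hρ : 0 < ρ) (hr : 0 < r)
    (hsub : ball x ρ ⊆ ball y r) :
    (∫ z in ball y r, mu ω z) * volume.real (ball x ρ) ^ (n + 1) ≤
      K₀ ^ n * volume.real (ball y r) ^ (n + 1) * ∫ z in ball x ρ, mu ω z := by
  have hω := h.integrableOn_ball x ρ
  have hωr := h.integrableOn_ball y r
  have hμ := integrableOn_mu hn h hK x hρ
  have hμr := integrableOn_mu hn h hK y hr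
  have hV := volume_real_ball_pos x hρ
  have hVr := volume_real_ball_pos y hr
  have hi := setIntegral_ball_pos h.ae_pos hρ hω
  have hiμ := setIntegral_ball_pos h.mu_pos hρ hμ
  have hiμr := setIntegral_ball_pos h.mu_pos hr hμr
  have hmono : ∫ z in ball x ρ, ω z ≤ ∫ z in ball y r, ω z :=
    setIntegral_mono_set hωr (Filter.Eventually.of_forall h.nonneg) hsub.eventuallyLE
  -- Hölder's inequality, obtained by integrating the pointwise bound `n + 1 ≤ n ω/c + (c/ω)^n` with
  -- `c` the mean of `ω`. The bound follows from Bernoulli for `(c/ω)^n` and `c/ω + ω/c ≥ 2`.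
  have holder : volume.real (ball x ρ) ^ (n + 1)
      ≤ (∫ z in ball x ρ, ω z) ^ n * ∫ z in ball x ρ, mu ω z := by
    set c := (∫ z in ball x ρ, ω z) / volume.real (ball x ρ) with hc
    have hcpos : 0 < c := by positivity
    have hpt : ∀ᵐ z ∂volume.restrict (ball x ρ), ((n : ℝ) + 1) ≤ n / c * ω z + c ^ n * mu ω z := by
      refine ae_restrict_of_ae (h.ae_pos.mono fun z hz => ?_)
      have hx0 : 0 < c / ω z := by positivity
      have b1 := one_add_mul_le_pow (a := c / ω z - 1) (by linarith) n
      have b2 : (c / ω z) ^ n = c ^ n * mu ω z := by rw [div_pow, mu, div_eq_mul_inv]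
      have b3 : 2 - c / ω z ≤ ω z / c := by
        have : 0 ≤ (c - ω z) ^ 2 / (c * ω z) := by positivity
        have e : (c - ω z) ^ 2 / (c * ω z) = c / ω z + ω z / c - 2 := by field_simp; ring
        linarith
      have b4 : (n : ℝ) * (2 - c / ω z) ≤ n * (ω z / c) := by gcongr
      have b5 : (n : ℝ) / c * ω z = n * (ω z / c) := by ring
      rw [add_sub_cancel] at b1
      rw [← b2, b5]
      linarith
    have : IsFiniteMeasure (volume.restrict (ball x ρ)) :=
      ⟨by simpa using measure_ball_lt_top⟩
    have hint := integral_mono_ae (integrable_const _)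
      ((hω.const_mul (n / c)).add (hμ.const_mul (c ^ n))) hpt
    simp only [Pi.add_apply] at hint
    rw [integral_add (hω.const_mul _) (hμ.const_mul _), integral_const_mul, integral_const_mul,
      setIntegral_const, smul_eq_mul] at hint
    have e1 : (n : ℝ) / c * ∫ z in ball x ρ, ω z = n * volume.real (ball x ρ) := by
      rw [hc]
      field_simp
    have h2 : volume.real (ball x ρ) ≤ c ^ n * ∫ z in ball x ρ, mu ω z := by linarith
    calc volume.real (ball x ρ) ^ (n + 1)
        = volume.real (ball x ρ) ^ n * volume.real (ball x ρ) := pow_succ _ _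
      _ ≤ volume.real (ball x ρ) ^ n * (c ^ n * ∫ z in ball x ρ, mu ω z) := by gcongr
      _ = _ := by
        rw [← mul_assoc, ← mul_pow, hc]
        congr 2
        field_simp
  have hA := setAverage_mul_setAverage_mu_le hn hK₀ h hK y hr
  have hA0 := setAverage_ball_pos h.mu_pos hr hμr
  have hW0 := setAverage_ball_pos h.ae_pos hr hωr
  have hA2 : (⨍ z in ball y r, ω z) ^ n * (⨍ z in ball y r, mu ω z) ≤ K₀ ^ n := by
    have := pow_le_pow_left₀ (by positivity) hA n
    rwa [mul_pow, ← Real.rpow_mul_natCast hA0.le, one_div, inv_mul_cancel₀ (by positivity),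
      Real.rpow_one] at this
  -- The Muckenhoupt condition on the large ball reverses Hölder there; the two combine through the
  -- monotonicity of `∫ ω`.
  have hA3 : (∫ z in ball y r, ω z) ^ n * (∫ z in ball y r, mu ω z)
      ≤ K₀ ^ n * volume.real (ball y r) ^ (n + 1) := by
    rw [← setAverage_mul_volume ω y hr, ← setAverage_mul_volume (mu ω) y hr]
    calc _ = (⨍ z in ball y r, ω z) ^ n * (⨍ z in ball y r, mu ω z)
          * volume.real (ball y r) ^ (n + 1) := by ring
      _ ≤ _ := by gcongr
  calc _ ≤ (∫ z in ball y r, mu ω z) *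
        ((∫ z in ball y r, ω z) ^ n * ∫ z in ball x ρ, mu ω z) := by
        gcongr
        exact holder.trans (by gcongr)
    _ = ((∫ z in ball y r, ω z) ^ n * (∫ z in ball y r, mu ω z)) * ∫ z in ball x ρ, mu ω z := by
        ring
    _ ≤ _ := by gcongr

/-! ### Estimates at the contact points -/

theorem posSemidef_neg_of_forall_nonpos {n : ℕ} {H : Matrix (Fin n) (Fin n) ℝ} (hs : H.IsSymm)
    (hH : ∀ ξ : Fin n → ℝ, ∑ i, ∑ j, H i j * ξ i * ξ j ≤ 0) : (-H).PosSemidef := by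
  refine Matrix.PosSemidef.of_dotProduct_mulVec_nonneg ?_ fun ξ => ?_
  · ext i j
    simpa using hs.apply i j
  · have h := hH ξ
    have e : star ξ ⬝ᵥ (-H).mulVec ξ = -∑ i, ∑ j, H i j * ξ i * ξ j := by
      simp only [dotProduct, Matrix.mulVec, star_trivial, Matrix.neg_apply, Finset.mul_sum,
        ← Finset.sum_neg_distrib]
      exact Finset.sum_congr rfl fun i _ => Finset.sum_congr rfl fun j _ => by ring
    rw [e]
    linarith

/-- At a point where `v_t ≥ 0` and `D²v ≤ 0`, the Jacobian of the Legendre transform is controlled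
by the operator. -/
theorem abs_det_mul_le {n : ℕ} {ν w b F : ℝ} (hν : 0 < ν) (hw : 0 < w) (hb : 0 ≤ b)
    {A H : Matrix (Fin n) (Fin n) ℝ}
    (hA : ∀ ξ : Fin n → ℝ, ν * ∑ i, ξ i ^ 2 ≤ ∑ i, ∑ j, A i j * ξ i * ξ j)
    (hs : H.IsSymm) (hH : ∀ ξ : Fin n → ℝ, ∑ i, ∑ j, H i j * ξ i * ξ j ≤ 0)
    (hF : b - w * ∑ i, ∑ j, A i j * H i j ≤ F) :
    |H.det * b| ≤ (ν ^ n)⁻¹ * (F ^ (n + 1) * (w ^ n)⁻¹) := by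
  have hP := posSemidef_neg_of_forall_nonpos hs hH
  have h1 := mul_trace_le_sum_mul hA hP
  have htr : 0 ≤ (-H).trace := hP.trace_nonneg
  have e1 : ∑ i, ∑ j, A i j * (-H) i j = -∑ i, ∑ j, A i j * H i j := by
    simp [Finset.sum_neg_distrib]
  rw [e1] at h1
  -- Both summands on the left are nonnegative, so `F` bounds each of them separately.
  have h2 : b + w * (ν * (-H).trace) ≤ F := by
    have := mul_le_mul_of_nonneg_left h1 hw.le
    linarith
  have h3 : 0 ≤ w * (ν * (-H).trace) := by positivity
  have hbF : b ≤ F := by linarith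
  have hF0 : 0 ≤ F := hb.trans hbF
  have htF : (-H).trace ≤ F / (w * ν) := by
    rw [le_div_iff₀ (by positivity)]
    linarith
  have e2 : |H.det| = (-H).det := by
    rw [← abs_of_nonneg hP.det_nonneg, Matrix.det_neg, abs_mul]
    simp
  rw [abs_mul, e2, abs_of_nonneg hb]
  calc (-H).det * b ≤ (-H).trace ^ n * b := by gcongr; exact det_le_trace_pow hP
    _ ≤ (F / (w * ν)) ^ n * F := by gcongr
    _ = _ := by
      rw [div_pow, mul_pow]
      field_simp
      ring

theorem sum_mul_barrier {n : ℕ} (A D : Matrix (Fin n) (Fin n) ℝ) (c : ℝ) :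
    ∑ i, ∑ j, A i j * (D - c • 1) i j = ∑ i, ∑ j, A i j * D i j - c * ∑ i, A i i := by
  simp [mul_sub, Finset.sum_sub_distrib, Matrix.one_apply, Finset.mul_sum, mul_comm]

/-- The operator applied to an approximate subsolution minus the barrier. -/
theorem operator_barrier_le {n : ℕ} (hn : 1 ≤ n) {ν w δ m ct cx b ut : ℝ} (hν : 0 < ν)
    (hν1 : ν < 1)
    (hw : 0 < w) {A H D : Matrix (Fin n) (Fin n) ℝ} (hA : ∀ i j, |A i j| ≤ ν⁻¹)
    (hut : ut - w * ∑ i, ∑ j, A i j * D i j ≤ 0) (hb : |b - ut| ≤ δ) (hm : 0 ≤ m)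
    (hct : 0 ≤ ct) (hcx : 0 ≤ cx) (hδt : δ ≤ m * ct) (hδx : δ ≤ m * cx)
    (hH : ∀ i j, |H i j - D i j| ≤ δ) :
    (b + 4 * m * ct) - w * ∑ i, ∑ j, A i j * (H - (8 * m * cx) • 1) i j
      ≤ 9 * n ^ 2 / ν * m * (ct + w * cx) := by
  have hn1 : (1 : ℝ) ≤ n := by exact_mod_cast hn
  rw [sum_mul_barrier]
  have h1 : ∑ i, A i i ≤ n * ν⁻¹ := by
    calc ∑ i, A i i ≤ ∑ _i : Fin n, ν⁻¹ :=
          Finset.sum_le_sum fun i _ => (le_abs_self _).trans (hA i i)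
      _ = _ := by simp
  have h2 : ∑ i, ∑ j, A i j * D i j - ∑ i, ∑ j, A i j * H i j ≤ n ^ 2 * (ν⁻¹ * δ) := by
    simp only [← Finset.sum_sub_distrib]
    calc _ ≤ ∑ _i : Fin n, ∑ _j : Fin n, ν⁻¹ * δ := by
          refine Finset.sum_le_sum fun i _ => Finset.sum_le_sum fun j _ => ?_
          rw [← mul_sub]
          refine (le_abs_self _).trans ?_
          rw [abs_mul, abs_sub_comm]
          exact mul_le_mul (hA i j) (hH i j) (abs_nonneg _) (by positivity)
      _ = _ := by
          simp
          ring
  have h3 : b ≤ ut + δ := by linarith [(abs_le.1 hb).2]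
  have h4 := mul_le_mul_of_nonneg_left h2 hw.le
  have h5 : w * (8 * m * cx * ∑ i, A i i) ≤ w * (8 * m * cx * (n * ν⁻¹)) := by gcongr
  have h6 : w * (n ^ 2 * (ν⁻¹ * δ)) ≤ w * (n ^ 2 * (ν⁻¹ * (m * cx))) := by gcongr
  have h7 : w * (8 * m * cx * (n * ν⁻¹)) ≤ w * (8 * m * cx * (n ^ 2 * ν⁻¹)) := by
    gcongr
    nlinarith
  -- In time, 4 comes from the barrier and 1 from the approximation error; in space, 8 from the
  -- Hessian of the barrier and 1 from the error, whence the 9.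
  have h8 : 5 * (m * ct) ≤ 9 * n ^ 2 / ν * (m * ct) := by
    gcongr
    rw [le_div_iff₀ hν]
    nlinarith
  have e : 9 * n ^ 2 / ν * m * (ct + w * cx)
      = 9 * n ^ 2 / ν * (m * ct) + w * (n ^ 2 * (ν⁻¹ * (m * cx)))
        + w * (8 * m * cx * (n ^ 2 * ν⁻¹)) := by
    rw [div_eq_mul_inv]
    ring
  rw [e]
  nlinarith

/-! ### The barrier -/

theorem hasFDerivAt_sub_barrier {n : ℕ} {x₀ : EuclideanSpace ℝ (Fin n)} {t₀ c cx ct b : ℝ}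
    {v : SpaceTime n → ℝ} {g : Fin n → ℝ} {X : SpaceTime n}
    (hv : HasFDerivAt v (∑ i, g i • dx i + b • dt) X) :
    HasFDerivAt (fun X : SpaceTime n =>
        v X - c - (cx * ∑ i, (X.1 i - x₀ i) ^ 2 + ct * (t₀ - X.2)))
      (∑ i, (g i - 2 * cx * (X.1 i - x₀ i)) • dx i + (b + ct) • dt) X := by
  have h1 : HasFDerivAt (fun X : SpaceTime n => ∑ i, (X.1 i - x₀ i) ^ 2)
      (∑ i, (2 * (X.1 i - x₀ i)) • dx i) X := by
    refine HasFDerivAt.fun_sum fun i _ => ?_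
    have := ((dx i).hasFDerivAt (x := X).sub_const (x₀ i)).pow 2
    simpa using this
  have h2 : HasFDerivAt (fun X : SpaceTime n => t₀ - X.2) (-dt) X :=
    (dt.hasFDerivAt (x := X)).const_sub t₀
  have h3 := (hv.sub_const c).sub ((h1.const_mul cx).add (h2.const_mul ct))
  have e : ∑ i, (g i - 2 * cx * (X.1 i - x₀ i)) • dx i + (b + ct) • dt
      = ∑ i, g i • dx i + b • dt - (cx • ∑ i, (2 * (X.1 i - x₀ i)) • dx i + ct • -dt) := by
    refine ContinuousLinearMap.ext fun Z => ?_
    simp [sub_mul, add_mul, Finset.sum_sub_distrib, Finset.mul_sum, mul_assoc, mul_left_comm]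
    ring
  rw [e]
  exact h3

theorem hasFDerivAt_gradient_sub_barrier {n : ℕ} {x₀ : EuclideanSpace ℝ (Fin n)} {cx k : ℝ}
    {g : SpaceTime n → ℝ} {h : Fin n → ℝ} {X : SpaceTime n} (i : Fin n)
    (hg : HasFDerivAt g (∑ j, h j • dx j + k • dt) X) :
    HasFDerivAt (fun X : SpaceTime n => g X - 2 * cx * (X.1 i - x₀ i))
      (∑ j, (h j - (2 * cx) * (1 : Matrix (Fin n) (Fin n) ℝ) i j) • dx j + k • dt) X := by
  have h1 : HasFDerivAt (fun X : SpaceTime n => 2 * cx * (X.1 i - x₀ i)) ((2 * cx) • dx i) X :=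
    ((dx i).hasFDerivAt.sub_const (x₀ i)).const_mul (2 * cx)
  have h2 := hg.sub h1
  have e : ∑ j, (h j - (2 * cx) * (1 : Matrix (Fin n) (Fin n) ℝ) i j) • dx j + k • dt
      = ∑ j, h j • dx j + k • dt - (2 * cx) • dx i := by
    refine ContinuousLinearMap.ext fun Z => ?_
    simp [sub_mul, Finset.sum_sub_distrib, Matrix.one_apply]
    ring
  rw [e]
  exact h2

/-! ### Integrals over cylinders -/

theorem ball_ae_eq_closedBall {n : ℕ} (x : EuclideanSpace ℝ (Fin n)) {ρ : ℝ} (hρ : 0 < ρ) :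
    (ball x ρ : Set (EuclideanSpace ℝ (Fin n))) =ᵐ[volume] closedBall x ρ := by
  refine (ball_subset_closedBall.eventuallyLE).antisymm (ae_le_set.2 ?_)
  rw [closedBall_sdiff_ball]
  exact Measure.addHaar_sphere_of_ne_zero volume x hρ.ne'

theorem setLIntegral_prod_fst {n : ℕ} {f : EuclideanSpace ℝ (Fin n) → ℝ≥0∞}
    {S : Set (EuclideanSpace ℝ (Fin n))}
    (hf : AEMeasurable f (volume.restrict S)) (T : Set ℝ) :
    ∫⁻ X in S ×ˢ T, f X.1 = (∫⁻ x in S, f x) * volume T := by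
  rw [Measure.volume_eq_prod, ← Measure.prod_restrict]
  have := lintegral_prod_mul (μ := volume.restrict S) (ν := volume.restrict T) (g := fun _ => 1)
    hf aemeasurable_const
  simpa using this

theorem ae_fst {n : ℕ} {p : EuclideanSpace ℝ (Fin n) → Prop} (h : ∀ᵐ x, p x) :
    ∀ᵐ X : SpaceTime n, p X.1 :=
  Measure.quasiMeasurePreserving_fst.ae h

/-! ### The local estimate -/

/-- The constant of the Krylov–Tso estimate with respect to `μ`. -/
noncomputable def measureConst (n : ℕ) (ν K₀ : ℝ) : ℝ :=
  (9 * n ^ 2 / ν) ^ (n + 1) * 2 ^ n * (1 + K₀) ^ (n + 1) * (ν ^ n)⁻¹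

theorem measureConst_pos {n : ℕ} (hn : 1 ≤ n) {ν K₀ : ℝ} (hν : 0 < ν) (hK₀ : 1 ≤ K₀) :
    0 < measureConst n ν K₀ := by
  have : (0 : ℝ) < n := by exact_mod_cast hn
  unfold measureConst
  positivity

/-- Use `w ≤ W + |w-W|` with `W ≤ K₀/τ`, and convexity of the power, which costs `2^n`. With `M =
ω^(-n)`, the last term is the integrand of the weighted oscillation. -/
theorem forcing_pow_le {n : ℕ} (hn : 1 ≤ n) {ν K₀ m ρ τ w W M : ℝ} (hν : 0 < ν) (hK₀ : 1 ≤ K₀)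
    (hm : 0 < m) (hρ : 0 < ρ) (hτ : 0 < τ) (hw : 0 < w) (hM : 0 ≤ M) (hWτ : W * τ ≤ K₀) :
    (ν ^ n)⁻¹ * ((9 * n ^ 2 / ν * m * ((ρ ^ 2 * τ)⁻¹ + w * (ρ ^ 2)⁻¹)) ^ (n + 1) * M) ≤
      measureConst n ν K₀ * (m / ρ ^ 2) ^ (n + 1) *
        ((τ⁻¹) ^ (n + 1) * M + |w - W| ^ (n + 1) * M) := by
  have hn0 : (0 : ℝ) < n := by exact_mod_cast hn
  have h1 : τ⁻¹ + w ≤ (1 + K₀) * τ⁻¹ + |w - W| := by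
    have : W ≤ K₀ * τ⁻¹ := by rw [← div_eq_mul_inv, le_div_iff₀ hτ]; exact hWτ
    have := le_abs_self (w - W)
    linarith
  have h2 : (τ⁻¹ + w) ^ (n + 1)
      ≤ 2 ^ n * (1 + K₀) ^ (n + 1) * ((τ⁻¹) ^ (n + 1) + |w - W| ^ (n + 1)) := by
    calc (τ⁻¹ + w) ^ (n + 1) ≤ ((1 + K₀) * τ⁻¹ + |w - W|) ^ (n + 1) := by gcongr
      _ ≤ 2 ^ n * (((1 + K₀) * τ⁻¹) ^ (n + 1) + |w - W| ^ (n + 1)) :=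
          add_pow_le (by positivity) (abs_nonneg _) (n + 1)
      _ ≤ 2 ^ n * (((1 + K₀) * τ⁻¹) ^ (n + 1) + (1 + K₀) ^ (n + 1) * |w - W| ^ (n + 1)) := by
          gcongr
          exact le_mul_of_one_le_left (by positivity) (one_le_pow₀ (by linarith))
      _ = _ := by
          rw [mul_pow]
          ring
  have e : 9 * n ^ 2 / ν * m * ((ρ ^ 2 * τ)⁻¹ + w * (ρ ^ 2)⁻¹)
      = 9 * n ^ 2 / ν * (m / ρ ^ 2) * (τ⁻¹ + w) := by
    field_simp
  rw [e, mul_pow, mul_pow, measureConst]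
  calc _ ≤ (ν ^ n)⁻¹ * ((9 * n ^ 2 / ν) ^ (n + 1) * (m / ρ ^ 2) ^ (n + 1) *
        (2 ^ n * (1 + K₀) ^ (n + 1) * ((τ⁻¹) ^ (n + 1) + |w - W| ^ (n + 1))) * M) := by gcongr
    _ = _ := by ring

/-- The Krylov–Tso estimate for a subsolution on a cylinder in which it is at most four times
its value at the center of the top. -/
theorem krylovTso_subsolution {n : ℕ} (hn : 1 ≤ n) {ν K₀ : ℝ} (hν : 0 < ν) (hν1 : ν < 1)
    (hK₀ : 1 ≤ K₀) {ω : EuclideanSpace ℝ (Fin n) → ℝ} (hωpos : ∀ᵐ x, 0 < ω x)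
    {U : Set (EuclideanSpace ℝ (Fin n))} (hU : IsOpen U) {s₀ s₁ : ℝ}
    {a : SpaceTime n → Matrix (Fin n) (Fin n) ℝ} (ha : IsElliptic ν a (U ×ˢ Ioo s₀ s₁))
    {u : SpaceTime n → ℝ} (hu : IsC21On u (U ×ˢ Ioo s₀ s₁))
    (hLu : ∀ᵐ X, X ∈ U ×ˢ Ioo s₀ s₁ → parabolicOp ω a u X ≤ 0)
    {x₀ : EuclideanSpace ℝ (Fin n)} {t₀ ρ τ W : ℝ} (hρ : 0 < ρ) (hτ : 0 < τ)
    (hball : closedBall x₀ ρ ⊆ U) (hbot : s₀ < t₀ - ρ ^ 2 * τ) (htop : t₀ < s₁)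
    (hWτ : W * τ ≤ K₀) (hm : 0 < u (x₀, t₀))
    (hmax : ∀ X ∈ closedBall x₀ ρ ×ˢ Icc (t₀ - ρ ^ 2 * τ) t₀, u X ≤ 4 * u (x₀, t₀)) :
    ∃ Γ : Set (SpaceTime n), MeasurableSet Γ ∧
      Γ ⊆ {X | X ∈ closedBall x₀ ρ ×ˢ Icc (t₀ - ρ ^ 2 * τ) t₀ ∧ u (x₀, t₀) / 2 ≤ u X} ∧
      volume (ball (0 : EuclideanSpace ℝ (Fin n)) (u (x₀, t₀) / (8 * ρ))) *
        ENNReal.ofReal (u (x₀, t₀) / 8) ≤ ∫⁻ X in Γ, ENNReal.ofReal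
          (measureConst n ν K₀ * (u (x₀, t₀) / ρ ^ 2) ^ (n + 1) *
            ((τ⁻¹) ^ (n + 1) * mu ω X.1 + |ω X.1 - W| ^ (n + 1) * mu ω X.1)) := by
  set m := u (x₀, t₀) with hmdef
  set h := ρ ^ 2 * τ with hh
  have hhpos : 0 < h := by positivity
  set K := closedBall x₀ ρ ×ˢ Icc (t₀ - h) t₀ with hK
  have hKΩ : K ⊆ U ×ˢ Ioo s₀ s₁ :=
    prod_mono hball fun t ht => ⟨hbot.trans_le ht.1, ht.2.trans_lt htop⟩
  -- The bound `m / 8` preserves the height at the vertex; the other two keep the approximation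
  -- error in the operator below the contribution of the barrier.
  obtain ⟨δ, hδ, hδ1, hδt, hδx⟩ : ∃ δ : ℝ, 0 < δ ∧ δ ≤ m / 8 ∧ δ ≤ m * h⁻¹ ∧
      δ ≤ m * (ρ ^ 2)⁻¹ := by
    refine ⟨min (m / 8) (min (m * h⁻¹) (m * (ρ ^ 2)⁻¹)), by positivity, min_le_left _ _,
      (min_le_right _ _).trans (min_le_left _ _), (min_le_right _ _).trans (min_le_right _ _)⟩
  obtain ⟨v, g, k, H, b, hv, hg, hbc, hHc, happ⟩ :=
    exists_approx_of_isC21On hU hu hball hbot htop hδ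
  -- With this `c`, `v' ≥ 0` forces `u ≥ m/2`. The barrier vanishes at `(x₀, t₀)`, where `v' ≥ m/2 -
  -- 2δ ≥ m/4`, and is at least `4m` on the bottom and the lateral boundary, where `v ≤ 4m + δ`
  -- makes `v'` negative.
  set c := m / 2 + δ with hc
  set cx := 4 * m * (ρ ^ 2)⁻¹ with hcx
  set ct := 4 * m * h⁻¹ with hct
  set v' : SpaceTime n → ℝ := fun X =>
    v X - c - (cx * ∑ i, (X.1 i - x₀ i) ^ 2 + ct * (t₀ - X.2)) with hv'
  set H' : SpaceTime n → Matrix (Fin n) (Fin n) ℝ := fun X => H X - (2 * cx) • 1 with hH'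
  set b' : SpaceTime n → ℝ := fun X => b X + ct with hb'
  have hsq : ∀ x : EuclideanSpace ℝ (Fin n), ∑ i, (x i - x₀ i) ^ 2 = dist x x₀ ^ 2 := by
    intro x
    rw [dist_eq_norm, EuclideanSpace.real_norm_sq_eq]
    rfl
  have hvK : ∀ X ∈ K, v X ≤ 4 * m + δ := fun X hX => by
    linarith [hmax X hX, (abs_le.1 (happ X hX).1).2]
  have hx₀K : ((x₀, t₀) : SpaceTime n) ∈ K :=
    ⟨mem_closedBall_self hρ.le, by simp only [mem_Icc]; constructor <;> linarith⟩
  have hcone := volume_cone_le_lintegral_contactSet (x₀ := x₀) (ρ := ρ) (a := t₀ - h) (b := t₀)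
    (M := m / 4) (v := v') (g := fun i X => g i X - 2 * cx * (X.1 i - x₀ i)) (H := H') (k := k)
    (β := b') hρ (by linarith)
    (fun X hX => hasFDerivAt_sub_barrier (hv X hX))
    (fun X hX i => hasFDerivAt_gradient_sub_barrier i (hg X hX i))
    (hbc.add continuousOn_const)
    (fun i j => (hHc i j).sub continuousOn_const) ?_ ?_ ?_
  · set Γ := contactSet K v' b' H' with hΓ
    have hKc : IsClosed K := isClosed_closedBall.prod isClosed_Icc
    have hΓm : MeasurableSet Γ := (isClosed_contactSet hKc
      (fun X hX => (hasFDerivAt_sub_barrier (hv X hX)).continuousAt.continuousWithinAt)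
      (hbc.add continuousOn_const)
      (fun i j => (hHc i j).sub continuousOn_const)).measurableSet
    refine ⟨Γ, hΓm, fun X hX => ⟨hX.1, ?_⟩, ?_⟩
    · have h1 := hX.2.1
      have h2 := (abs_le.1 (happ X hX.1).1).2
      have h3 : 0 ≤ cx * ∑ i, (X.1 i - x₀ i) ^ 2 := by
        rw [hsq]
        positivity
      have h4 : 0 ≤ ct * (t₀ - X.2) :=
        mul_nonneg (by positivity) (by linarith [hX.1.2.2])
      simp only [hv'] at h1
      linarith
    · rw [show m / (8 * ρ) = m / 4 / (2 * ρ) by field_simp; norm_num, show m / 8 = m / 4 / 2 by ring]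
      refine hcone.trans (lintegral_mono_ae ?_)
      filter_upwards [ae_restrict_mem hΓm, ae_restrict_of_ae hLu,
        ae_restrict_of_ae (ae_fst hωpos)] with X hX hLX hωX
      refine ENNReal.ofReal_le_ofReal ?_
      have hXΩ := hKΩ hX.1
      obtain ⟨-, ha2, ha3, ha4⟩ := happ X hX.1
      have hell : ∀ ξ : Fin n → ℝ, ν * ∑ i, ξ i ^ 2 ≤ ∑ i, ∑ j, a X i j * ξ i * ξ j := by
        intro ξ
        have := ha.elliptic X hXΩ (WithLp.toLp 2 ξ)
        rwa [EuclideanSpace.real_norm_sq_eq] at this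
      have hop := operator_barrier_le hn hν hν1 hωX (ha.bounded X hXΩ) (hLX hXΩ) ha2 hm.le
        (inv_nonneg.2 hhpos.le) (by positivity : 0 ≤ (ρ ^ 2)⁻¹) hδt hδx
        (H := H X) (D := Matrix.of fun i j => spaceDeriv i (spaceDeriv j u) X) ha4
      have e8 : 8 * m * (ρ ^ 2)⁻¹ = 2 * cx := by rw [hcx]; ring
      rw [e8] at hop
      have hsymm : (H' X).IsSymm := by
        simp only [hH']
        exact ha3.sub (Matrix.isSymm_one.smul _)
      refine (abs_det_mul_le hν hωX hX.2.2.1 hell hsymm hX.2.2.2 hop).trans ?_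
      exact forcing_pow_le hn hν hK₀ hm hρ hτ hωX (inv_nonneg.2 (by positivity)) hWτ
  · intro x hx
    have h1 := hvK (x, t₀ - h) ⟨hx, by simp only [mem_Icc]; constructor <;> linarith⟩
    have h2 : ct * (t₀ - (t₀ - h)) = 4 * m := by
      rw [hct]
      field_simp
      ring
    have h3 : 0 ≤ cx * ∑ i, (x i - x₀ i) ^ 2 := by
      rw [hsq]
      positivity
    simp only [hv']
    rw [h2]
    linarith
  · intro x hx t ht
    have h1 := hvK (x, t) ⟨sphere_subset_closedBall hx, ht⟩
    have h2 : cx * ∑ i, (x i - x₀ i) ^ 2 = 4 * m := by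
      rw [hsq, mem_sphere.1 hx, hcx]
      field_simp
    have h4 : 0 ≤ ct * (t₀ - t) := mul_nonneg (by positivity) (by linarith [ht.2])
    simp only [hv']
    rw [h2]
    linarith
  · have h2 := (abs_le.1 (happ _ hx₀K).1).1
    simp only [hv', sub_self]
    simp
    linarith

/-- Here `V` and `A` stand for the Lebesgue and `μ` measures of the ball, and `me` for the
`μ`-measure of the superlevel set. The left side of `key` and its oscillation term both scale like
`(m/ρ²)^(n+1) τ^(-(n+1)) h A`, so this factor cancels, and smallness of `ε` absorbs the oscillation
into half of the left side. -/
theorem density_algebra {n : ℕ} {C K₀ ε m ρ τ W A V κ h me : ℝ} (hC : 0 < C)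
    (hε : 0 ≤ ε) (hm : 0 < m) (hρ : 0 < ρ) (hτ : 0 < τ) (hκ : 0 < κ)
    (hV : V = ρ ^ n * κ) (hA : A = τ ^ n * V) (hh : h = ρ ^ 2 * τ) (hWτ : W * τ ≤ K₀)
    (hεC : 2 * C * K₀ * 8 ^ (n + 1) * ε ^ (n + 1) ≤ 1)
    (key : (m / (8 * ρ)) ^ n * κ * (m / 8) ≤
      C * (m / ρ ^ 2) ^ (n + 1) * ((τ⁻¹) ^ (n + 1) * me + h * (ε ^ (n + 1) * (W * V)))) :
    (2 * C * 8 ^ (n + 1))⁻¹ * (h * A) ≤ me := by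
  set Q := ρ ^ (n + 2) * κ * τ ^ (n + 1) with hQ
  have hQ0 : 0 < Q := by positivity
  have hhA : h * A = Q := by rw [hh, hA, hV, hQ]; ring
  have e1 : (m / (8 * ρ)) ^ n * κ * (m / 8)
      = (m / ρ ^ 2) ^ (n + 1) * (τ⁻¹) ^ (n + 1) * (Q * (8 ^ (n + 1))⁻¹) := by
    rw [hQ, div_pow, div_pow, inv_pow, mul_pow]
    field_simp
    ring
  have e2 : h * (ε ^ (n + 1) * (W * V)) = (τ⁻¹) ^ (n + 1) * (ε ^ (n + 1) * (W * τ) * Q) := by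
    rw [hQ, hh, hV, inv_pow]
    field_simp
    ring
  have e3 : C * (m / ρ ^ 2) ^ (n + 1) * ((τ⁻¹) ^ (n + 1) * me
      + (τ⁻¹) ^ (n + 1) * (ε ^ (n + 1) * (W * τ) * Q))
      = (m / ρ ^ 2) ^ (n + 1) * (τ⁻¹) ^ (n + 1) * (C * me + C * (ε ^ (n + 1) * (W * τ) * Q)) := by
    ring
  rw [e1, e2, e3] at key
  have k2 := le_of_mul_le_mul_left key (by positivity)
  have k3 : C * (ε ^ (n + 1) * (W * τ) * Q) ≤ C * (ε ^ (n + 1) * K₀ * Q) := by gcongr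
  have k4 : C * (ε ^ (n + 1) * K₀ * Q) ≤ Q * (8 ^ (n + 1))⁻¹ / 2 := by
    rw [← div_eq_mul_inv, div_div, le_div_iff₀ (by positivity)]
    nlinarith
  rw [hhA, inv_mul_le_iff₀ (by positivity)]
  have k5 : Q * (8 ^ (n + 1))⁻¹ ≤ 2 * (C * me) := by linarith
  rw [← div_eq_mul_inv, div_le_iff₀ (by positivity)] at k5
  linarith

/-- Under a small mean oscillation condition, the set where a subsolution is at least half of its
value at the center of the top occupies a fixed fraction of the cylinder. -/
theorem le_lintegral_superlevel {n : ℕ} (hn : 1 ≤ n) {ν K₀ ε : ℝ} (hν : 0 < ν) (hν1 : ν < 1)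
    (hK₀ : 1 ≤ K₀) (hε : 0 ≤ ε)
    (hεC : 2 * measureConst n ν K₀ * K₀ * 8 ^ (n + 1) * ε ^ (n + 1) ≤ 1)
    {ω : EuclideanSpace ℝ (Fin n) → ℝ} (hω : IsMuckenhoupt (1 + 1 / (n : ℝ)) ω)
    (hK : muckenhouptChar (1 + 1 / (n : ℝ)) ω ≤ ENNReal.ofReal K₀)
    {U : Set (EuclideanSpace ℝ (Fin n))} (hU : IsOpen U)
    (hbmo : weightedBMO ω ω U ≤ ENNReal.ofReal ε) {s₀ s₁ : ℝ}
    {a : SpaceTime n → Matrix (Fin n) (Fin n) ℝ} (ha : IsElliptic ν a (U ×ˢ Ioo s₀ s₁))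
    {u : SpaceTime n → ℝ} (hu : IsC21On u (U ×ˢ Ioo s₀ s₁))
    (hLu : ∀ᵐ X, X ∈ U ×ˢ Ioo s₀ s₁ → parabolicOp ω a u X ≤ 0)
    {x₀ : EuclideanSpace ℝ (Fin n)} {t₀ ρ h : ℝ} (hρ : 0 < ρ)
    (hh : h = ρ ^ 2 * (⨍ x in ball x₀ ρ, mu ω x) ^ (1 / (n : ℝ)))
    (hball : closedBall x₀ ρ ⊆ U) (hbot : s₀ < t₀ - h) (htop : t₀ < s₁)
    (hm : 0 < u (x₀, t₀))
    (hmax : ∀ X ∈ closedBall x₀ ρ ×ˢ Icc (t₀ - h) t₀, u X ≤ 4 * u (x₀, t₀)) :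
    ENNReal.ofReal ((2 * measureConst n ν K₀ * 8 ^ (n + 1))⁻¹ * (h * ∫ x in ball x₀ ρ, mu ω x)) ≤
      ∫⁻ X in {X | X ∈ closedBall x₀ ρ ×ˢ Icc (t₀ - h) t₀ ∧ u (x₀, t₀) / 2 ≤ u X},
        ENNReal.ofReal (mu ω X.1) := by
  set m := u (x₀, t₀)
  set E := {X : SpaceTime n | X ∈ closedBall x₀ ρ ×ˢ Icc (t₀ - h) t₀ ∧ m / 2 ≤ u X}
  have hμ := integrableOn_mu hn hω hK x₀ hρ
  have hω1 := hω.integrableOn_ball x₀ ρ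
  have hA0 := setAverage_ball_pos hω.mu_pos hρ hμ
  have hn' : (0 : ℝ) < n := by exact_mod_cast hn
  set W := ⨍ x in ball x₀ ρ, ω x with hW
  set τ := (⨍ x in ball x₀ ρ, mu ω x) ^ (1 / (n : ℝ)) with hτ
  have hτ0 : 0 < τ := Real.rpow_pos_of_pos hA0 _
  have hτn : (⨍ x in ball x₀ ρ, mu ω x) = τ ^ n := by
    rw [hτ, ← Real.rpow_mul_natCast hA0.le, one_div, inv_mul_cancel₀ hn'.ne', Real.rpow_one]
  have hWτ : W * τ ≤ K₀ := setAverage_mul_setAverage_mu_le hn (by linarith) hω hK x₀ hρ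
  have hC := measureConst_pos hn hν hK₀
  have hh0 : 0 < h := by rw [hh]; positivity
  have hμ0 : ∀ x, 0 ≤ mu ω x := mu_nonneg hω.nonneg
  obtain ⟨Γ, -, hΓ, hcone⟩ := krylovTso_subsolution hn hν hν1 hK₀ hω.ae_pos hU ha hu hLu hρ hτ0
    hball (hh ▸ hbot) htop hWτ hm (hh ▸ hmax)
  rw [← hh] at hΓ
  have hΓE : Γ ⊆ E := hΓ
  have hΓK : Γ ⊆ closedBall x₀ ρ ×ˢ Icc (t₀ - h) t₀ := fun X hX => (hΓ hX).1
  have hae : AEMeasurable (fun x => |ω x - W| ^ (n + 1) * mu ω x) volume := by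
    have h1 := hω.locallyIntegrable.aestronglyMeasurable.aemeasurable
    have h2 := hω.aestronglyMeasurable_mu.aemeasurable
    fun_prop
  have hosc : ∫⁻ X in Γ, ENNReal.ofReal (|ω X.1 - W| ^ (n + 1) * mu ω X.1) ≤
      ENNReal.ofReal (h * (ε ^ (n + 1) * ∫ x in ball x₀ ρ, ω x)) := by
    calc _ ≤ ∫⁻ X in closedBall x₀ ρ ×ˢ Icc (t₀ - h) t₀,
          ENNReal.ofReal (|ω X.1 - W| ^ (n + 1) * mu ω X.1) := lintegral_mono_set hΓK
      _ = (∫⁻ x in ball x₀ ρ, ENNReal.ofReal (|ω x - W| ^ (n + 1) * mu ω x))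
          * ENNReal.ofReal h := by
        rw [setLIntegral_prod_fst (f := fun x => ENNReal.ofReal (|ω x - W| ^ (n + 1) * mu ω x))
          hae.ennreal_ofReal.restrict,
          Measure.restrict_congr_set (ball_ae_eq_closedBall x₀ hρ), Real.volume_Icc,
          sub_sub_cancel]
      _ ≤ ENNReal.ofReal (ε ^ (n + 1) * ∫ x in ball x₀ ρ, ω x) * ENNReal.ofReal h := by
        gcongr
        exact lintegral_oscillation_le hε hω hbmo hρ (ball_subset_closedBall.trans hball)
      _ = _ := by rw [← ENNReal.ofReal_mul' hh0.le, mul_comm]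
  have hμae : AEMeasurable (fun X : SpaceTime n => ENNReal.ofReal ((τ⁻¹) ^ (n + 1) * mu ω X.1))
      (volume.restrict Γ) := by
    have : AEMeasurable (fun X : SpaceTime n => mu ω X.1) volume :=
      hω.aestronglyMeasurable_mu.aemeasurable.comp_fst
    exact ((this.const_mul _).ennreal_ofReal).restrict
  by_cases htopE : ∫⁻ X in E, ENNReal.ofReal (mu ω X.1) = ∞
  · rw [htopE]
    exact le_top
  set me := (∫⁻ X in E, ENNReal.ofReal (mu ω X.1)).toReal with hme
  have hmeE : ∫⁻ X in E, ENNReal.ofReal (mu ω X.1) = ENNReal.ofReal me :=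
    (ENNReal.ofReal_toReal htopE).symm
  have hme0 : 0 ≤ me := ENNReal.toReal_nonneg
  rw [hmeE]
  refine ENNReal.ofReal_le_ofReal ?_
  set κ := volume.real (ball (0 : EuclideanSpace ℝ (Fin n)) 1) with hκ
  have hκ0 : 0 < κ := volume_real_ball_pos _ one_pos
  have hvol : ∀ (x : EuclideanSpace ℝ (Fin n)) {r : ℝ}, 0 < r →
      volume (ball x r) = ENNReal.ofReal (r ^ n * κ) := by
    intro x r hr
    rw [Measure.addHaar_ball_of_pos volume x hr, finrank_euclideanSpace_fin,
      ENNReal.ofReal_mul (by positivity), hκ, ofReal_measureReal measure_ball_lt_top.ne]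
  have hV : volume.real (ball x₀ ρ) = ρ ^ n * κ := by
    rw [measureReal_def, hvol x₀ hρ, ENNReal.toReal_ofReal (by positivity)]
  have hW0 : 0 < ∫ x in ball x₀ ρ, ω x := setIntegral_ball_pos hω.ae_pos hρ hω1
  refine density_algebra (V := volume.real (ball x₀ ρ)) (W := W) (m := m) hC hε hm hρ hτ0 hκ0 hV
    (by rw [← hτn, setAverage_mul_volume _ _ hρ]) hh hWτ hεC ?_
  have hRHS : ∫⁻ X in Γ, ENNReal.ofReal (measureConst n ν K₀ * (m / ρ ^ 2) ^ (n + 1) *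
      ((τ⁻¹) ^ (n + 1) * mu ω X.1 + |ω X.1 - W| ^ (n + 1) * mu ω X.1)) ≤
      ENNReal.ofReal (measureConst n ν K₀ * (m / ρ ^ 2) ^ (n + 1) *
        ((τ⁻¹) ^ (n + 1) * me + h * (ε ^ (n + 1) * (W * volume.real (ball x₀ ρ))))) := by
    have hc2 : 0 ≤ measureConst n ν K₀ * (m / ρ ^ 2) ^ (n + 1) := by positivity
    have e1 : ∀ X : SpaceTime n, ENNReal.ofReal (measureConst n ν K₀ * (m / ρ ^ 2) ^ (n + 1) *
        ((τ⁻¹) ^ (n + 1) * mu ω X.1 + |ω X.1 - W| ^ (n + 1) * mu ω X.1))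
        = ENNReal.ofReal (measureConst n ν K₀ * (m / ρ ^ 2) ^ (n + 1)) *
          (ENNReal.ofReal ((τ⁻¹) ^ (n + 1) * mu ω X.1)
            + ENNReal.ofReal (|ω X.1 - W| ^ (n + 1) * mu ω X.1)) := by
      intro X
      have := hμ0 X.1
      rw [ENNReal.ofReal_mul hc2, ENNReal.ofReal_add (by positivity) (by positivity)]
    simp only [e1]
    rw [lintegral_const_mul' _ _ ENNReal.ofReal_ne_top, lintegral_add_left' hμae,
      ENNReal.ofReal_mul hc2]
    gcongr
    rw [ENNReal.ofReal_add (by positivity)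
      (by rw [hW, setAverage_mul_volume _ _ hρ]; positivity)]
    gcongr
    · have e2 : ∀ X : SpaceTime n, ENNReal.ofReal ((τ⁻¹) ^ (n + 1) * mu ω X.1)
          = ENNReal.ofReal ((τ⁻¹) ^ (n + 1)) * ENNReal.ofReal (mu ω X.1) := fun X =>
        ENNReal.ofReal_mul (by positivity)
      simp only [e2]
      rw [lintegral_const_mul' _ _ ENNReal.ofReal_ne_top, ENNReal.ofReal_mul (by positivity),
        ← hmeE]
      gcongr
    · rw [hW, setAverage_mul_volume _ _ hρ]
      exact hosc
  have hfin := hcone.trans hRHS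
  rw [hvol 0 (by positivity), ← ENNReal.ofReal_mul (by positivity)] at hfin
  refine (ENNReal.ofReal_le_ofReal_iff ?_).1 hfin
  have : 0 ≤ W * volume.real (ball x₀ ρ) := by
    rw [hW, setAverage_mul_volume _ _ hρ]
    exact hW0.le
  positivity

/-! ### Comparison of cylinders -/

/-- The height `ρ² (μ)_{B_ρ(x)}^(1/n)` of the cylinder over `B_ρ(x)`. -/
noncomputable def height {n : ℕ} (μ : EuclideanSpace ℝ (Fin n) → ℝ)
    (x : EuclideanSpace ℝ (Fin n)) (ρ : ℝ) : ℝ :=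
  ρ ^ 2 * (⨍ z in ball x ρ, μ z) ^ (1 / (n : ℝ))

theorem exists_height_eq {n : ℕ} (hn : 1 ≤ n) {μ : EuclideanSpace ℝ (Fin n) → ℝ}
    (hμ : ∀ᵐ x, 0 < μ x) (x : EuclideanSpace ℝ (Fin n)) {ρ : ℝ} (hρ : 0 < ρ)
    (hi : IntegrableOn μ (ball x ρ)) :
    ∃ τ : ℝ, 0 < τ ∧ height μ x ρ = ρ ^ 2 * τ ∧
      ∫ z in ball x ρ, μ z = τ ^ n * volume.real (ball x ρ) := by
  have hA0 := setAverage_ball_pos hμ hρ hi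
  have hn' : (0 : ℝ) < n := by exact_mod_cast hn
  refine ⟨_, Real.rpow_pos_of_pos hA0 (1 / (n : ℝ)), rfl, ?_⟩
  rw [← Real.rpow_mul_natCast hA0.le, one_div, inv_mul_cancel₀ hn'.ne', Real.rpow_one,
    setAverage_mul_volume _ _ hρ]

theorem volume_real_ball {n : ℕ} (x : EuclideanSpace ℝ (Fin n)) {r : ℝ} (hr : 0 < r) :
    volume.real (ball x r)
      = r ^ n * volume.real (ball (0 : EuclideanSpace ℝ (Fin n)) 1) := by
  rw [measureReal_def, Measure.addHaar_ball_of_pos volume x hr, finrank_euclideanSpace_fin,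
    ENNReal.toReal_mul, ENNReal.toReal_ofReal (by positivity), measureReal_def]

/-- With `τ` the `n`-th root of the mean of `μ`, `(ρτ)^n` is proportional to the `μ`-measure of the
ball, which is monotone under inclusion. The height is `ρ · ρτ`, and the remaining factor `ρ` gives
the ratio `ρ / r`. -/
theorem height_le {n : ℕ} (hn : 1 ≤ n) {μ : EuclideanSpace ℝ (Fin n) → ℝ}
    (hμ : ∀ᵐ x, 0 < μ x) {x y : EuclideanSpace ℝ (Fin n)} {ρ r : ℝ} (hρ : 0 < ρ) (hr : 0 < r)
    (hi : IntegrableOn μ (ball y r)) (hsub : ball x ρ ⊆ ball y r) :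
    height μ x ρ ≤ ρ / r * height μ y r := by
  obtain ⟨τ, hτ, e1, e2⟩ := exists_height_eq hn hμ x hρ (hi.mono_set hsub)
  obtain ⟨σ, hσ, e3, e4⟩ := exists_height_eq hn hμ y hr hi
  have hmono : ∫ z in ball x ρ, μ z ≤ ∫ z in ball y r, μ z :=
    setIntegral_mono_set hi (ae_restrict_of_ae (hμ.mono fun z hz => hz.le)) hsub.eventuallyLE
  have hκ := volume_real_ball_pos (0 : EuclideanSpace ℝ (Fin n)) one_pos
  rw [e2, e4, volume_real_ball x hρ, volume_real_ball y hr, ← mul_assoc, ← mul_assoc,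
    ← mul_pow, ← mul_pow] at hmono
  have h1 := le_of_mul_le_mul_right hmono hκ
  have h2 : τ * ρ ≤ σ * r := le_of_pow_le_pow_left₀ (by omega) (by positivity) h1
  rw [e1, e3]
  have e5 : ρ / r * (r ^ 2 * σ) = ρ * (σ * r) := by field_simp
  rw [e5, pow_two, mul_assoc, mul_comm ρ τ]
  gcongr

/-- Doubling for cylinders. With `R = r/ρ`, doubling on balls gives `σ ≤ K₀ R^n τ` for the roots of
the means. The product scales like `r^(n+2) σ^(n+1)`, which accounts for the exponents `n(n+1)` and
`n+2`. -/
theorem height_mul_le {n : ℕ} (hn : 1 ≤ n) {K₀ : ℝ} (hK₀ : 0 ≤ K₀)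
    {ω : EuclideanSpace ℝ (Fin n) → ℝ} (h : IsMuckenhoupt (1 + 1 / (n : ℝ)) ω)
    (hK : muckenhouptChar (1 + 1 / (n : ℝ)) ω ≤ ENNReal.ofReal K₀)
    {x y : EuclideanSpace ℝ (Fin n)} {ρ r : ℝ} (hρ : 0 < ρ) (hr : 0 < r)
    (hsub : ball x ρ ⊆ ball y r) :
    height (mu ω) y r * (∫ z in ball y r, mu ω z) ≤
      K₀ ^ (n + 1) * (r / ρ) ^ (n * (n + 1) + n + 2) *
        (height (mu ω) x ρ * ∫ z in ball x ρ, mu ω z) := by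
  obtain ⟨τ, hτ, e1, e2⟩ := exists_height_eq hn h.mu_pos x hρ (integrableOn_mu hn h hK x hρ)
  obtain ⟨σ, hσ, e3, e4⟩ := exists_height_eq hn h.mu_pos y hr (integrableOn_mu hn h hK y hr)
  have hd := setIntegral_mu_doubling hn hK₀ h hK hρ hr hsub
  set κ := volume.real (ball (0 : EuclideanSpace ℝ (Fin n)) 1)
  have hκ : 0 < κ := volume_real_ball_pos (0 : EuclideanSpace ℝ (Fin n)) one_pos
  rw [e2, e4, volume_real_ball x hρ, volume_real_ball y hr] at hd
  rw [e1, e2, e3, e4, volume_real_ball x hρ, volume_real_ball y hr]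
  set R := r / ρ with hR
  have hR0 : 0 < R := by positivity
  have hrR : r = R * ρ := by rw [hR]; field_simp
  have h1 : σ ^ n ≤ (K₀ * R ^ n * τ) ^ n := by
    have hpos : 0 < R ^ n * (ρ ^ n * κ) ^ (n + 2) := by positivity
    refine le_of_mul_le_mul_right ?_ hpos
    have c1 : σ ^ n * (R ^ n * (ρ ^ n * κ) ^ (n + 2))
        = σ ^ n * (r ^ n * κ) * (ρ ^ n * κ) ^ (n + 1) := by
      rw [hrR, mul_pow]
      ring
    have c2 : (K₀ * R ^ n * τ) ^ n * (R ^ n * (ρ ^ n * κ) ^ (n + 2))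
        = K₀ ^ n * (r ^ n * κ) ^ (n + 1) * (τ ^ n * (ρ ^ n * κ)) := by
      rw [hrR, mul_pow R ρ, mul_pow, mul_pow, mul_assoc (R ^ n) (ρ ^ n) κ,
        mul_pow (R ^ n) (ρ ^ n * κ)]
      ring
    rw [c1, c2]
    exact hd
  have h2 : σ ≤ K₀ * R ^ n * τ := le_of_pow_le_pow_left₀ (by omega) (by positivity) h1
  calc r ^ 2 * σ * (σ ^ n * (r ^ n * κ))
      ≤ r ^ 2 * (K₀ * R ^ n * τ) * ((K₀ * R ^ n * τ) ^ n * (r ^ n * κ)) := by gcongr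
    _ = _ := by
      rw [hrR, mul_pow R ρ 2, mul_pow R ρ n, mul_pow, mul_pow, ← pow_mul]
      ring

/-! ### Integrals over parabolic cylinders -/

theorem integrableOn_comp_fst {n : ℕ} {f : EuclideanSpace ℝ (Fin n) → ℝ}
    {S : Set (EuclideanSpace ℝ (Fin n))} (hf : IntegrableOn f S) (a b : ℝ) :
    IntegrableOn (fun X : SpaceTime n => f X.1) (S ×ˢ Ioo a b) := by
  have : IsFiniteMeasure (volume.restrict (Ioo a b)) := ⟨by simp⟩
  rw [IntegrableOn, Measure.volume_eq_prod, ← Measure.prod_restrict]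
  exact hf.comp_fst _

theorem setIntegral_comp_fst {n : ℕ} (f : EuclideanSpace ℝ (Fin n) → ℝ)
    (S : Set (EuclideanSpace ℝ (Fin n))) {a b : ℝ} (hab : a ≤ b) :
    ∫ X in S ×ˢ Ioo a b, f (X : SpaceTime n).1 = (b - a) * ∫ x in S, f x := by
  rw [Measure.volume_eq_prod]
  have := setIntegral_prod_mul (μ := volume) (ν := volume) f (fun _ : ℝ => (1 : ℝ)) S (Ioo a b)
  simpa [hab, mul_comm] using this

/-! ### The local maximum principle -/

/-- A normalized distance to the parabolic boundary of a cylinder. -/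
noncomputable def boundaryDist {n : ℕ} (y : EuclideanSpace ℝ (Fin n)) (s r H : ℝ)
    (X : SpaceTime n) : ℝ :=
  min (1 - dist X.1 y / r) (1 - (s - X.2) / H)

theorem boundaryDist_pos {n : ℕ} {y : EuclideanSpace ℝ (Fin n)} {s r H : ℝ} (hr : 0 < r)
    (hH : 0 < H) {X : SpaceTime n} (hX : X ∈ ball y r ×ˢ Ioo (s - H) s) :
    0 < boundaryDist y s r H X := by
  have h1 : dist X.1 y < r := hX.1
  have h2 := hX.2.1
  refine lt_min ?_ ?_
  · rw [sub_pos, div_lt_one hr]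
    exact h1
  · rw [sub_pos, div_lt_one hH]
    linarith

theorem boundaryDist_le_one {n : ℕ} {y : EuclideanSpace ℝ (Fin n)} {s r H : ℝ} (hr : 0 < r)
    (X : SpaceTime n) : boundaryDist y s r H X ≤ 1 := by
  refine (min_le_left _ _).trans ?_
  have : 0 ≤ dist X.1 y / r := by positivity
  linarith

/-- Moving by at most `θ d r` in space or `θ d H` in time changes the corresponding entry of the
minimum by at most `θ d`. -/
theorem le_boundaryDist {n : ℕ} {y x₀ : EuclideanSpace ℝ (Fin n)} {s r H t₀ θ h : ℝ} (hr : 0 < r)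
    (hH : 0 < H) (hh : h ≤ θ * boundaryDist y s r H (x₀, t₀) * H)
    {X : SpaceTime n}
    (hX : X ∈ closedBall x₀ (θ * boundaryDist y s r H (x₀, t₀) * r) ×ˢ Icc (t₀ - h) t₀) :
    (1 - θ) * boundaryDist y s r H (x₀, t₀) ≤ boundaryDist y s r H X := by
  set d := boundaryDist y s r H (x₀, t₀) with hd
  have h1 : d ≤ 1 - dist x₀ y / r := min_le_left _ _
  have h2 : d ≤ 1 - (s - t₀) / H := min_le_right _ _
  have h3 : dist X.1 x₀ ≤ θ * d * r := hX.1
  have h4 := hX.2.1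
  refine le_min ?_ ?_
  · have h5 : dist X.1 y / r ≤ θ * d + dist x₀ y / r := by
      rw [div_le_iff₀ hr, add_mul, div_mul_cancel₀ _ hr.ne']
      linarith [dist_triangle X.1 x₀ y]
    linarith
  · have h5 : (s - X.2) / H ≤ θ * d + (s - t₀) / H := by
      rw [div_le_iff₀ hH, add_mul, div_mul_cancel₀ _ hH.ne']
      linarith
    linarith

theorem exists_pow_one_sub_ge {α : ℝ} (hα : 0 < α) :
    ∃ θ : ℝ, 0 < θ ∧ θ < 1 ∧ (1 / 2 : ℝ) ≤ (1 - θ) ^ α := by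
  have h0 : (0 : ℝ) < (1 / 2 : ℝ) ^ (1 / α) := by positivity
  have h1 : (1 / 2 : ℝ) ^ (1 / α) < 1 :=
    Real.rpow_lt_one (by norm_num) (by norm_num) (by positivity)
  refine ⟨1 - (1 / 2 : ℝ) ^ (1 / α), by linarith, by linarith, ?_⟩
  rw [sub_sub_cancel, ← Real.rpow_mul (by norm_num), one_div_mul_cancel hα.ne', Real.rpow_one]

/-- The distance equals 1 at `(y, s)`, so the supremum of `d^α u` is at least `u(y, s)`. The
distance does not vanish on the top, so the supremum over the open cylinder need not be attained; a
point above half of it is taken. -/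
theorem exists_near_maximizer {n : ℕ} {y : EuclideanSpace ℝ (Fin n)} {s r H α : ℝ} (hr : 0 < r)
    (hH : 0 < H) (hα : 0 < α) {u : SpaceTime n → ℝ}
    (hu : ContinuousOn u (closure (ball y r ×ˢ Ioo (s - H) s))) (hpos : 0 < u (y, s)) :
    ∃ X₀ ∈ ball y r ×ˢ Ioo (s - H) s, 0 < u X₀ ∧
      u (y, s) ≤ 2 * (boundaryDist y s r H X₀ ^ α * u X₀) ∧
      ∀ X ∈ ball y r ×ˢ Ioo (s - H) s,
        boundaryDist y s r H X ^ α * u X ≤ 2 * (boundaryDist y s r H X₀ ^ α * u X₀) := by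
  set C := ball y r ×ˢ Ioo (s - H) s with hC
  set d := boundaryDist y s r H with hd
  set F : SpaceTime n → ℝ := fun X => d X ^ α * u X with hF
  have hcomp : IsCompact (closure C) :=
    ((isCompact_closedBall y r).prod (isCompact_Icc (a := s - H) (b := s))).of_isClosed_subset
      isClosed_closure (closure_minimal (prod_mono ball_subset_closedBall Ioo_subset_Icc_self)
        (isClosed_closedBall.prod isClosed_Icc))
  obtain ⟨B, hB⟩ := hcomp.exists_bound_of_continuousOn hu
  have hbdd : BddAbove (F '' C) := by
    refine ⟨B, ?_⟩
    rintro _ ⟨X, hX, rfl⟩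
    have h1 : |u X| ≤ B := hB X (subset_closure hX)
    have h2 : d X ^ α ≤ 1 :=
      Real.rpow_le_one (boundaryDist_pos hr hH hX).le (boundaryDist_le_one hr X) hα.le
    have h3 : 0 ≤ d X ^ α := Real.rpow_nonneg (boundaryDist_pos hr hH hX).le _
    calc F X ≤ d X ^ α * |u X| := by simp only [hF]; gcongr; exact le_abs_self _
      _ ≤ 1 * |u X| := by gcongr
      _ ≤ B := by linarith
  have hcurve : ∀ t ∈ Ioo (s - H) s, ((y, t) : SpaceTime n) ∈ C := fun t ht =>
    ⟨mem_ball_self hr, ht⟩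
  -- The vertex lies outside the open cylinder and is reached only as a limit along its axis.
  have hlim : Filter.Tendsto (fun t : ℝ => F (y, t)) (nhdsWithin s (Iio s)) (nhds (u (y, s))) := by
    have hIoo : Ioo (s - H) s ∈ nhdsWithin s (Iio s) := Ioo_mem_nhdsLT (by linarith)
    have h1 : Filter.Tendsto (fun t : ℝ => ((y, t) : SpaceTime n)) (nhdsWithin s (Iio s))
        (nhdsWithin (y, s) (closure C)) := by
      refine tendsto_nhdsWithin_iff.2 ⟨?_, ?_⟩
      · exact (Continuous.tendsto (by fun_prop) s).mono_left nhdsWithin_le_nhds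
      · filter_upwards [hIoo] with t ht using subset_closure (hcurve t ht)
    have hY : ((y, s) : SpaceTime n) ∈ closure C := by
      rw [hC, closure_prod_eq, closure_Ioo (by linarith)]
      exact ⟨subset_closure (mem_ball_self hr), right_mem_Icc.2 (by linarith)⟩
    have h2 := (hu (y, s) hY).tendsto.comp h1
    have h3 : Filter.Tendsto (fun t : ℝ => d (y, t)) (nhdsWithin s (Iio s)) (nhds 1) := by
      have hc : Continuous fun t : ℝ => d (y, t) := by
        simp only [hd, boundaryDist]
        fun_prop
      have h4 := (hc.tendsto s).mono_left (nhdsWithin_le_nhds (s := Iio s))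
      have e : d (y, s) = 1 := by simp [hd, boundaryDist]
      rwa [e] at h4
    have h5 := (h3.rpow_const (p := α) (Or.inl one_ne_zero)).mul h2
    rw [Real.one_rpow, one_mul] at h5
    exact h5
  have hS : u (y, s) ≤ sSup (F '' C) := by
    refine le_of_tendsto hlim ?_
    filter_upwards [Ioo_mem_nhdsLT (show s - H < s by linarith)] with t ht
    exact le_csSup hbdd (mem_image_of_mem F (hcurve t ht))
  have hne : (F '' C).Nonempty :=
    ⟨_, mem_image_of_mem F (hcurve (s - H / 2) ⟨by linarith, by linarith⟩)⟩
  obtain ⟨_, ⟨X₀, hX₀, rfl⟩, hlt⟩ := exists_lt_of_lt_csSup hne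
    (show sSup (F '' C) / 2 < sSup (F '' C) by linarith)
  refine ⟨X₀, hX₀, ?_, by linarith, fun X hX => ?_⟩
  · have h1 : 0 < F X₀ := by linarith
    exact pos_of_mul_pos_right h1 (Real.rpow_nonneg (boundaryDist_pos hr hH hX₀).le _)
  · have := le_csSup hbdd (mem_image_of_mem F hX)
    simp only [hF] at this hlt
    linarith

/-- Chebyshev's inequality. Boundedness of `u` on the compact closure makes `(u⁺)^q μ` integrable,
so the Bochner integral on the right is the true one. -/
theorem ofReal_mul_lintegral_superlevel_le {n : ℕ} {y : EuclideanSpace ℝ (Fin n)}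
    {s₀ s₁ r q c : ℝ} (hq : 0 < q) (hc : 0 < c)
    {μ : EuclideanSpace ℝ (Fin n) → ℝ} (hμ0 : ∀ x, 0 ≤ μ x) (hμ : IntegrableOn μ (ball y r))
    {u : SpaceTime n → ℝ} (hu : ContinuousOn u (closure (ball y r ×ˢ Ioo s₀ s₁)))
    {K : Set (SpaceTime n)} (hK : IsClosed K) (hKC : K ⊆ ball y r ×ˢ Ioo s₀ s₁) :
    ENNReal.ofReal (c ^ q) * ∫⁻ X in {X | X ∈ K ∧ c ≤ u X}, ENNReal.ofReal (μ X.1) ≤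
      ENNReal.ofReal (∫ X in ball y r ×ˢ Ioo s₀ s₁, max (u X) 0 ^ q * μ X.1) := by
  set C := ball y r ×ˢ Ioo s₀ s₁ with hC
  have hCm : MeasurableSet C := measurableSet_ball.prod measurableSet_Ioo
  have hcomp : IsCompact (closure C) :=
    ((isCompact_closedBall y r).prod (isCompact_Icc (a := s₀) (b := s₁))).of_isClosed_subset
      isClosed_closure (closure_minimal (prod_mono ball_subset_closedBall Ioo_subset_Icc_self)
        (isClosed_closedBall.prod isClosed_Icc))
  obtain ⟨B, hB⟩ := hcomp.exists_bound_of_continuousOn hu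
  have hcont : ContinuousOn (fun X => max (u X) 0 ^ q) C :=
    ((hu.mono subset_closure).sup continuousOn_const).rpow_const fun _ _ => Or.inr hq.le
  have hint : IntegrableOn (fun X : SpaceTime n => max (u X) 0 ^ q * μ X.1) C := by
    refine Integrable.bdd_mul (c := max B 0 ^ q) (integrableOn_comp_fst hμ s₀ s₁)
      (hcont.aestronglyMeasurable hCm) ?_
    filter_upwards [ae_restrict_mem hCm] with X hX
    have h1 : u X ≤ B := (le_abs_self _).trans (hB X (subset_closure hX))
    rw [Real.norm_eq_abs, abs_of_nonneg (by positivity)]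
    gcongr
  have hEc : IsClosed {X | X ∈ K ∧ c ≤ u X} :=
    (hu.mono (hKC.trans subset_closure)).preimage_isClosed_of_isClosed hK isClosed_Ici
  rw [ofReal_integral_eq_lintegral_ofReal hint (Filter.Eventually.of_forall fun X =>
    mul_nonneg (by positivity) (hμ0 X.1)), ← lintegral_const_mul' _ _ ENNReal.ofReal_ne_top]
  calc _ ≤ ∫⁻ X in {X | X ∈ K ∧ c ≤ u X}, ENNReal.ofReal (max (u X) 0 ^ q * μ X.1) := by
        refine setLIntegral_mono_ae' hEc.measurableSet (Filter.Eventually.of_forall fun X hX => ?_)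
        rw [← ENNReal.ofReal_mul (by positivity)]
        refine ENNReal.ofReal_le_ofReal (mul_le_mul_of_nonneg_right ?_ (hμ0 X.1))
        exact Real.rpow_le_rpow hc.le (hX.2.trans (le_max_left _ _)) hq.le
    _ ≤ _ := lintegral_mono_set fun X hX => hKC hX.1

end WeightedParabolic

open WeightedParabolic in
theorem corollary3p2 (n : ℕ) (hn : 1 ≤ n) (K₀ : ℝ) (hK₀ : 1 ≤ K₀)
    (ν : ℝ) (hν₀ : 0 < ν) (hν₁ : ν < 1) :
    ∃ ε : ℝ, 0 < ε ∧ ε < 1 ∧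
      ∀ q : ℝ, 0 < q →
        ∃ N : ℝ, 0 < N ∧
          ∀ (ω : EuclideanSpace ℝ (Fin n) → ℝ)
            (a : WeightedParabolic.SpaceTime n → Matrix (Fin n) (Fin n) ℝ)
            (r : ℝ) (Y : WeightedParabolic.SpaceTime n),
            0 < r →
            WeightedParabolic.IsMuckenhoupt (1 + 1 / (n : ℝ)) ω →
            WeightedParabolic.muckenhouptChar (1 + 1 / (n : ℝ)) ω ≤ ENNReal.ofReal K₀ →
            WeightedParabolic.weightedBMO ω ω (ball Y.1 r) ≤ ENNReal.ofReal ε →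
            WeightedParabolic.IsElliptic ν a
              (WeightedParabolic.parabolicCylinder (WeightedParabolic.mu ω) r Y) →
            ∀ u : WeightedParabolic.SpaceTime n → ℝ,
              WeightedParabolic.IsC21On u
                (WeightedParabolic.parabolicCylinder (WeightedParabolic.mu ω) r Y) →
              ContinuousOn u
                (closure (WeightedParabolic.parabolicCylinder (WeightedParabolic.mu ω) r Y)) →
              (∀ᵐ X ∂volume, X ∈ WeightedParabolic.parabolicCylinder (WeightedParabolic.mu ω) r Y →
                WeightedParabolic.parabolicOp ω a u X ≤ 0) →
              max (u Y) 0 ≤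
                N * ((∫ X in WeightedParabolic.parabolicCylinder (WeightedParabolic.mu ω) r Y,
                        (max (u X) 0) ^ q * WeightedParabolic.mu ω X.1) /
                      (∫ X in WeightedParabolic.parabolicCylinder (WeightedParabolic.mu ω) r Y,
                        WeightedParabolic.mu ω X.1)) ^ (1 / q) := by
  have hC1 := measureConst_pos hn hν₀ hK₀
  have hP0 : 0 < 2 * measureConst n ν K₀ * K₀ * 8 ^ (n + 1) := by positivity
  obtain ⟨ε, hε0, hε1, hεC⟩ : ∃ ε : ℝ, 0 < ε ∧ ε < 1 ∧
      2 * measureConst n ν K₀ * K₀ * 8 ^ (n + 1) * ε ^ (n + 1) ≤ 1 := by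
    refine ⟨min (1 / 2) (2 * measureConst n ν K₀ * K₀ * 8 ^ (n + 1))⁻¹, by positivity,
      (min_le_left _ _).trans_lt (by norm_num), ?_⟩
    have h1 : min (1 / 2) (2 * measureConst n ν K₀ * K₀ * 8 ^ (n + 1))⁻¹ ^ (n + 1)
        ≤ (2 * measureConst n ν K₀ * K₀ * 8 ^ (n + 1))⁻¹ :=
      (pow_le_of_le_one (by positivity) ((min_le_left _ _).trans (by norm_num))
        (Nat.succ_ne_zero n)).trans (min_le_right _ _)
    exact (mul_le_mul_of_nonneg_left h1 hP0.le).trans_eq (mul_inv_cancel₀ hP0.ne')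
  refine ⟨ε, hε0, hε1, fun q hq => ?_⟩
  -- `D` is the doubling exponent of cylinders in `height_mul_le`; the exponent `D / q` is chosen so
  -- that the `q`-th power of the weight is `d ^ D`.
  set D : ℕ := n * (n + 1) + n + 2 with hD
  have hα : 0 < (D : ℝ) / q := by positivity
  obtain ⟨θ, hθ0, hθ1, hθ⟩ := exists_pow_one_sub_ge hα
  set c := (2 * measureConst n ν K₀ * 8 ^ (n + 1))⁻¹ with hc
  have hc0 : 0 < c := by positivity
  refine ⟨(4 ^ q * K₀ ^ (n + 1) / (c * θ ^ D)) ^ (1 / q), by positivity, ?_⟩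
  rintro ω a r ⟨y, s⟩ hr hω hK hbmo ha u hu huc hLu
  set H := height (mu ω) y r with hH
  have hcyl : parabolicCylinder (mu ω) r (y, s) = ball y r ×ˢ Ioo (s - H) s := rfl
  rw [hcyl] at ha hu huc hLu ⊢
  have hμ := integrableOn_mu hn hω hK y hr
  have hμ0 : ∀ x, 0 ≤ mu ω x := mu_nonneg hω.nonneg
  obtain ⟨τ, hτ, hHτ, -⟩ := exists_height_eq hn hω.mu_pos y hr hμ
  have hH0 : 0 < H := by rw [hH, hHτ]; positivity
  have hMr := setIntegral_ball_pos hω.mu_pos hr hμ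
  rw [setIntegral_comp_fst (mu ω) (ball y r) (by linarith : s - H ≤ s), sub_sub_cancel]
  set I := ∫ X in ball y r ×ˢ Ioo (s - H) s, max (u X) 0 ^ q * mu ω X.1 with hI
  have hI0 : 0 ≤ I := integral_nonneg fun X => mul_nonneg (by positivity) (hμ0 X.1)
  rcases le_or_gt (u (y, s)) 0 with hneg | hpos
  · rw [max_eq_right hneg]
    positivity
  rw [max_eq_left hpos.le]
  obtain ⟨⟨x₀, t₀⟩, hX₀, hu₀, huY, hsup⟩ := exists_near_maximizer hr hH0 hα huc hpos
  set d := boundaryDist y s r H (x₀, t₀) with hd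
  have hd0 : 0 < d := boundaryDist_pos hr hH0 hX₀
  have hd1 : d ≤ 1 := boundaryDist_le_one hr _
  set ρ := θ * d * r with hρ
  have hρ0 : 0 < ρ := by positivity
  have hθd : θ * d < d := mul_lt_of_lt_one_left hd0 hθ1
  have hdx : d ≤ 1 - dist x₀ y / r := min_le_left _ _
  have hdt : d ≤ 1 - (s - t₀) / H := min_le_right _ _
  have hball : closedBall x₀ ρ ⊆ ball y r := by
    intro x hx
    have h1 : dist x₀ y ≤ (1 - d) * r := by
      rw [← div_le_iff₀ hr]
      linarith
    have h2 : ρ < d * r := mul_lt_mul_of_pos_right hθd hr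
    have := dist_triangle x x₀ y
    rw [mem_closedBall] at hx
    rw [mem_ball]
    linarith
  have hballs : ball x₀ ρ ⊆ ball y r := ball_subset_closedBall.trans hball
  set h := height (mu ω) x₀ ρ with hh
  have hhH : h ≤ θ * d * H := by
    have := height_le hn hω.mu_pos hρ0 hr hμ hballs
    rwa [hρ, mul_div_cancel_right₀ _ hr.ne'] at this
  have hbot : s - H < t₀ - h := by
    have h1 : s - t₀ ≤ (1 - d) * H := by
      rw [← div_le_iff₀ hH0]
      linarith
    have h2 : θ * d * H < d * H := mul_lt_mul_of_pos_right hθd hH0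
    linarith
  have htop : t₀ < s := hX₀.2.2
  set Q := closedBall x₀ ρ ×ˢ Icc (t₀ - h) t₀ with hQ
  have hQC : Q ⊆ ball y r ×ˢ Ioo (s - H) s :=
    prod_mono hball fun t ht => ⟨hbot.trans_le ht.1, ht.2.trans_lt htop⟩
  -- One factor 2 comes from the choice of the point, the other from the loss `(1-θ)^(D/q) ≥ 1/2` in
  -- the weight.
  have hmax : ∀ X ∈ Q, u X ≤ 4 * u (x₀, t₀) := by
    intro X hX
    have h1 : (1 - θ) * d ≤ boundaryDist y s r H X := le_boundaryDist hr hH0 hhH hX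
    have h2 := hsup X (hQC hX)
    rcases le_or_gt (u X) 0 with hneg | hposX
    · linarith
    have h3 : (1 / 2 : ℝ) * d ^ ((D : ℝ) / q) ≤ boundaryDist y s r H X ^ ((D : ℝ) / q) := by
      calc (1 / 2 : ℝ) * d ^ ((D : ℝ) / q)
          ≤ (1 - θ) ^ ((D : ℝ) / q) * d ^ ((D : ℝ) / q) := by gcongr
        _ = ((1 - θ) * d) ^ ((D : ℝ) / q) := (Real.mul_rpow (by linarith) hd0.le).symm
        _ ≤ _ := Real.rpow_le_rpow (mul_nonneg (by linarith) hd0.le) h1 hα.le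
    have h4 : 0 < d ^ ((D : ℝ) / q) := by positivity
    have h5 := (mul_le_mul_of_nonneg_right h3 hposX.le).trans h2
    have h6 : d ^ ((D : ℝ) / q) * u X ≤ d ^ ((D : ℝ) / q) * (4 * u (x₀, t₀)) := by linarith
    exact le_of_mul_le_mul_left h6 h4
  have hdens := le_lintegral_superlevel hn hν₀ hν₁ hK₀ hε0.le hεC hω hK isOpen_ball hbmo ha hu hLu
    hρ0 hh hball hbot htop hu₀ hmax
  have hlev := ofReal_mul_lintegral_superlevel_le (c := u (x₀, t₀) / 2) hq (by positivity) hμ0 hμ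
    huc (isClosed_closedBall.prod isClosed_Icc) hQC
  have hmain : (u (x₀, t₀) / 2) ^ q * (c * (h * ∫ x in ball x₀ ρ, mu ω x)) ≤ I := by
    have h1 := (mul_le_mul_right hdens (ENNReal.ofReal ((u (x₀, t₀) / 2) ^ q))).trans hlev
    rw [← ENNReal.ofReal_mul (by positivity)] at h1
    exact (ENNReal.ofReal_le_ofReal_iff hI0).1 h1
  have hcomp := height_mul_le hn (by linarith) hω hK hρ0 hr hballs
  rw [← hH, ← hh, ← hD] at hcomp
  have hrρ : r / ρ = (θ * d)⁻¹ := by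
    rw [hρ]
    field_simp
  rw [hrρ, inv_pow, mul_pow] at hcomp
  have hdD : (d ^ ((D : ℝ) / q)) ^ q = d ^ D := by
    rw [← Real.rpow_mul hd0.le, div_mul_cancel₀ _ hq.ne', Real.rpow_natCast]
  have hYq : u (y, s) ^ q ≤ 2 ^ q * (d ^ D * u (x₀, t₀) ^ q) := by
    have h1 := Real.rpow_le_rpow hpos.le huY hq.le
    rwa [Real.mul_rpow (by norm_num) (by positivity), Real.mul_rpow (by positivity) hu₀.le,
      hdD] at h1
  have h4 : (4 : ℝ) ^ q = 2 ^ q * 2 ^ q := by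
    rw [← Real.mul_rpow (by norm_num) (by norm_num)]
    norm_num
  -- The factors `d ^ D` from the weight and from doubling cancel here. In `4 ^ q`, one `2 ^ q`
  -- comes from the near-maximum and one from the level `u (x₀, t₀) / 2`.
  have hfin : u (y, s) ^ q ≤ 4 ^ q * K₀ ^ (n + 1) / (c * θ ^ D) *
      (I / (H * ∫ x in ball y r, mu ω x)) := by
    rw [div_mul_div_comm, le_div_iff₀ (by positivity)]
    rw [Real.div_rpow hu₀.le (by norm_num), div_mul_eq_mul_div, div_le_iff₀ (by positivity)] at hmain
    set m := ∫ x in ball x₀ ρ, mu ω x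
    set M := ∫ x in ball y r, mu ω x
    calc u (y, s) ^ q * (c * θ ^ D * (H * M))
        ≤ 2 ^ q * (d ^ D * u (x₀, t₀) ^ q) * (c * θ ^ D *
          (K₀ ^ (n + 1) * (θ ^ D * d ^ D)⁻¹ * (h * m))) := by gcongr
      _ = 2 ^ q * K₀ ^ (n + 1) * (u (x₀, t₀) ^ q * (c * (h * m))) := by
          field_simp
      _ ≤ 2 ^ q * K₀ ^ (n + 1) * (I * 2 ^ q) := by gcongr
      _ = 4 ^ q * K₀ ^ (n + 1) * I := by rw [h4]; ring
  have h5 := Real.rpow_le_rpow (by positivity) hfin (show 0 ≤ 1 / q by positivity)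
  rwa [← Real.rpow_mul hpos.le, mul_one_div_cancel hq.ne', Real.rpow_one,
    Real.mul_rpow (by positivity) (by positivity)] at h5
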